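/- Let $d\ge 2$ and $n\ge 1$ be integers and let $c,t>0$. A random flight in $\mathbb{R}^d$ with $n$ changes of direction in $[0,t]$ starts at the origin and moves at constant speed $c$; its $n+1$ steps have durations $\tau_1,\dots,\tau_n>0$ and $\tau_{n+1}=t-\sum_{j=1}^n\tau_j>0$, and its position at time $t$ is $c\sum_{j=1}^{n+1}\tau_jU_j$. The directions are $$U_j=(\cos\theta_{1,j},\ \sin\theta_{1,j}\cos\theta_{2,j},\ \dots,\ \sin\theta_{1,j}\cdots\sin\theta_{d-2,j}\cos\phi_j,\ \sin\theta_{1,j}\cdots\sin\theta_{d-2,j}\sin\phi_j),$$ where the $n+1$ vectors of angles $(\theta_{1,j},\dots,\theta_{d-2,j},\phi_j)\in[0,\pi]^{d-2}\times[0,2\pi]$ are independent of each other and of $(\tau_1,\dots,\tau_n)$ and have the density $$\frac{\Gamma(\frac d2)}{2\pi^{d/2}}\sin^{d-2}\theta_1\sin^{d-3}\theta_2\cdots\sin\theta_{d-2}$$ (uniform directions on the unit sphere). For $q>0$, say that the durations are Dirichlet with parameter $q$ if $(\tau_1,\dots,\tau_n)$ has the density $$\frac{\Gamma((n+1)q)}{\Gamma(q)^{n+1}}\,\frac{1}{t^{(n+1)q-1}}\prod_{j=1}^{n+1}\tau_j^{q-1}$$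 on the set where $\tau_1,\dots,\tau_{n+1}>0$. Let $\mathbf X_d(t)$ be the position of the flight whose durations are Dirichlet with parameter $d-1$ ($d\ge2$), let $\mathbf Y_d(t)$ be the position of the flight whose durations are Dirichlet with parameter $\frac d2-1$ ($d\ge3$), and put $R_d(t)=\|\mathbf X_d(t)\|$ and $L_d(t)=\|\mathbf Y_d(t)\|$. Then, for every real $p\ge1$, these $p$-th moments are finite and $$E\left[R_d(t)^p\right]=\frac{\Gamma(\frac{p+d}2)\,\Gamma(\frac{n+1}2(d-1)+\frac12)}{\Gamma(\frac d2)\,\Gamma(\frac{p+d}2+\frac n2(d-1))}\,(ct)^p,\qquad d\ge2,$$ $$E\left[L_d(t)^p\right]=\frac{\Gamma(\frac{p+d}2)\,\Gamma((n+1)(\frac d2-1)+1)}{\Gamma(\frac d2)\,\Gamma(\frac{p+d}2+n(\frac d2-1))}\,(ct)^p,\qquad d\ge3.$$ -/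

import Mathlib

open MeasureTheory ProbabilityTheory

noncomputable section

namespace RandomFlight

/-- The unit vector of `ℝ^d` with hyperspherical angles `(θ₁, …, θ_{d-2}, φ)`, stored as
`a 0, …, a (d-3), a (d-2)`:
`(cos θ₁, sin θ₁ cos θ₂, …, sin θ₁ ⋯ sin θ_{d-2} cos φ, sin θ₁ ⋯ sin θ_{d-2} sin φ)`. -/
def direction (d : ℕ) (a : Fin (d - 1) → ℝ) : EuclideanSpace ℝ (Fin d) :=
  WithLp.toLp 2 fun i : Fin d =>
    (∏ j : Fin (d - 1), if (j : ℕ) < (i : ℕ) then Real.sin (a j) else 1) *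
      (if h : (i : ℕ) < d - 1 then Real.cos (a ⟨i, h⟩) else 1)

/-- The range of the angles: `0 ≤ θ₁, …, θ_{d-2} ≤ π` and `0 ≤ φ ≤ 2π`. -/
def angleBox (d : ℕ) : Set (Fin (d - 1) → ℝ) :=
  {a | ∀ j : Fin (d - 1), 0 ≤ a j ∧
    a j ≤ if (j : ℕ) + 1 < d - 1 then Real.pi else 2 * Real.pi}

/-- The density of the orientation,
`Γ(d/2) / (2 π^{d/2}) · sin^{d-2} θ₁ · sin^{d-3} θ₂ ⋯ sin θ_{d-2}`. -/
def angleDensity (d : ℕ) (a : Fin (d - 1) → ℝ) : ℝ :=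
  Real.Gamma ((d : ℝ) / 2) / (2 * Real.pi ^ ((d : ℝ) / 2)) *
    ∏ j : Fin (d - 1), Real.sin (a j) ^ (d - 2 - (j : ℕ))

/-- The law of the angles of one displacement: the direction is uniform on the unit sphere. -/
def angleLaw (d : ℕ) : Measure (Fin (d - 1) → ℝ) :=
  (volume.restrict (angleBox d)).withDensity fun a => ENNReal.ofReal (angleDensity d a)

/-- The durations `τ₁, …, τ_n, τ_{n+1}` of the `n + 1` steps, where
`τ_{n+1} = t - (τ₁ + ⋯ + τ_n)`. -/
def durations {n : ℕ} (t : ℝ) (s : Fin n → ℝ) : Fin (n + 1) → ℝ :=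
  Fin.snoc s (t - ∑ k, s k)

/-- The domain of `(τ₁, …, τ_n)`: `τ_j > 0` for `1 ≤ j ≤ n + 1`. -/
def durationDomain (n : ℕ) (t : ℝ) : Set (Fin n → ℝ) :=
  {s | (∀ k, 0 < s k) ∧ ∑ k, s k < t}

/-- The density of `(τ₁, …, τ_n)` on its domain for the Dirichlet distribution with parameters
`(q, …, q)`, rescaled to total length `t`:
`Γ((n+1)q) / Γ(q)^{n+1} · t^{-((n+1)q-1)} · ∏_{j=1}^{n+1} τ_j^{q-1}`. -/
def durationDensity (n : ℕ) (q t : ℝ) (s : Fin n → ℝ) : ℝ :=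
  Real.Gamma (((n : ℝ) + 1) * q) / Real.Gamma q ^ (n + 1) *
    (1 / t ^ (((n : ℝ) + 1) * q - 1)) * ∏ j : Fin (n + 1), durations t s j ^ (q - 1)

/-- The rescaled Dirichlet law with parameters `(q, …, q)` of the durations `(τ₁, …, τ_n)`. -/
def durationLaw (n : ℕ) (q t : ℝ) : Measure (Fin n → ℝ) :=
  (volume.restrict (durationDomain n t)).withDensity fun s =>
    ENNReal.ofReal (durationDensity n q t s)

/-- The position at time `t` of the walker that starts at the origin and moves at speed `c`
for the time `τ_j` in the direction with angles `a j`, `1 ≤ j ≤ n + 1`. -/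
def position {d n : ℕ} (c t : ℝ) (s : Fin n → ℝ) (a : Fin (n + 1) → Fin (d - 1) → ℝ) :
    EuclideanSpace ℝ (Fin d) :=
  c • ∑ j : Fin (n + 1), durations t s j • direction d (a j)

/-- The random data of a flight in `ℝ^d` on `[0, t]` with `n` changes of direction: the
durations `τ` have the rescaled Dirichlet law with parameters `(q, …, q)`, the orientations
`θ j` of the `n + 1` displacements are independent and uniform, and the family of the
orientations is independent of the durations. -/
structure IsFlight {Ω : Type*} [MeasurableSpace Ω] (P : Measure Ω) (d n : ℕ) (q t : ℝ)
    (τ : Ω → Fin n → ℝ) (θ : Fin (n + 1) → Ω → Fin (d - 1) → ℝ) : Prop where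
  hasLaw_durations : HasLaw τ (durationLaw n q t) P
  hasLaw_angles : ∀ j, HasLaw (θ j) (angleLaw d) P
  iIndepFun_angles : iIndepFun θ P
  indepFun : IndepFun τ (fun ω j => θ j ω) P

end RandomFlight

end

/-!
Let `V = ∑ j, τ j • U j` be the position at unit speed. The squared distance `‖V‖² / t²` has a beta
law with parameters `d / 2` and `B - d / 2`, where `Q = (n + 1) q` is the total Dirichlet parameter
and `B = (Q + 1) / 2` if `q = d - 1`, `B = Q + 1` if `q = d / 2 - 1`; the stated `p`-th moments are
the real moments of these beta laws. The beta law is identified by its integer moments, which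
determine a law on `[0, 1]` (`integral_eq_of_moments_eq`).

The moments of a linear form under the law of the directions are computed in spherical coordinates
by recursion on the dimension (`setIntegral_angleBox`). They depend on the form through its length
only, so averaging `⟪V, U⟫ ^ (2m)` over one more independent uniform direction `U` reduces
`E ‖V‖ ^ (2m)` to the moment of a one-dimensional projection of `V`
(`IsFlight.integral_norm_pow`). That projection is expanded by the multinomial theorem. With the
mixed moments of the Dirichlet law (`integral_prod_durations_pow`) the expansion becomes the
coefficient of `z ^ m` in the `(n + 1)`-st power of a generating function
(`IsFlight.integral_projection_pow`).

The two parameters of the theorem are those for which this power is explicit: the duplication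
formula turns the generating function into `(1 - z) ^ (-q / 2)` if `q = d - 1` and into
`(2 / (1 + √(1 - z))) ^ q` if `q = d / 2 - 1`, so that taking powers multiplies `q` by `n + 1`
(`mk_flightCoeff_half_pow`, `mk_flightCoeff_add_one_pow`). On coefficients this is a convolution
identity for polynomials in `q`, proved from a difference equation
(`eval_add_eq_sum_antidiagonal`).
-/

namespace RandomFlight

/-! ### Trigonometric integrals and the Gamma function -/

lemma Gamma_add_natCast {x : ℝ} (hx : 0 < x) (k : ℕ) :
    Real.Gamma (x + k) = (ascPochhammer ℝ k).eval x * Real.Gamma x := by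
  induction k with
  | zero => simp
  | succ k ih =>
    rw [Nat.cast_succ, ← add_assoc, Real.Gamma_add_one (by positivity), ih,
      ascPochhammer_succ_eval]
    ring

lemma integral_sin_pow_eq_Gamma (l : ℕ) :
    ∫ x in (0 : ℝ)..Real.pi, Real.sin x ^ l =
      Real.Gamma (1 / 2) * Real.Gamma (((l : ℝ) + 1) / 2) / Real.Gamma ((l : ℝ) / 2 + 1) := by
  induction l using Nat.twoStepInduction with
  | zero =>
    simp [-one_div, Real.Gamma_one_half_eq, Real.mul_self_sqrt Real.pi_pos.le]
  | one =>
    have h : Real.Gamma ((1 : ℝ) / 2 + 1) = 1 / 2 * Real.Gamma (1 / 2) :=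
      Real.Gamma_add_one (by norm_num)
    have h0 : Real.Gamma (1 / 2) ≠ 0 := (Real.Gamma_pos_of_pos (by norm_num)).ne'
    have h1 : Real.Gamma ((1 + 1 : ℝ) / 2) = 1 := by norm_num
    simp only [pow_one, integral_sin, Nat.cast_one]
    rw [h, h1]
    field_simp
    norm_num
  | more l ih _ =>
    have e1 : (((l + 2 : ℕ) : ℝ) + 1) / 2 = ((l : ℝ) + 1) / 2 + 1 := by push_cast; ring
    have e2 : ((l + 2 : ℕ) : ℝ) / 2 + 1 = ((l : ℝ) / 2 + 1) + 1 := by push_cast; ring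
    have h0 : Real.Gamma ((l : ℝ) / 2 + 1) ≠ 0 := (Real.Gamma_pos_of_pos (by positivity)).ne'
    rw [integral_sin_pow, ih, e1, e2, Real.Gamma_add_one (s := ((l : ℝ) + 1) / 2) (by positivity),
      Real.Gamma_add_one (s := (l : ℝ) / 2 + 1) (by positivity)]
    simp only [Real.sin_zero, Real.sin_pi, ne_eq, Nat.succ_ne_zero, not_false_eq_true, zero_pow,
      zero_mul, sub_self, zero_div, zero_add]
    field_simp

/-- The trigonometric form of the beta integral. -/
lemma integral_cos_pow_even_mul_sin_pow (a l : ℕ) :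
    ∫ x in (0 : ℝ)..Real.pi, Real.cos x ^ (2 * a) * Real.sin x ^ l =
      Real.Gamma ((a : ℝ) + 1 / 2) * Real.Gamma (((l : ℝ) + 1) / 2) /
        Real.Gamma ((a : ℝ) + (l : ℝ) / 2 + 1) := by
  induction a generalizing l with
  | zero => simpa using integral_sin_pow_eq_Gamma l
  | succ a ih =>
    have h : ∀ x : ℝ, Real.cos x ^ (2 * (a + 1)) * Real.sin x ^ l =
        Real.cos x ^ (2 * a) * Real.sin x ^ l - Real.cos x ^ (2 * a) * Real.sin x ^ (l + 2) := by
      intro x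
      have := Real.sin_sq_add_cos_sq x
      rw [show Real.cos x ^ (2 * (a + 1)) = Real.cos x ^ (2 * a) * Real.cos x ^ 2 by ring,
        ← sub_eq_of_eq_add' this.symm]
      ring
    simp only [h]
    rw [intervalIntegral.integral_sub (by apply Continuous.intervalIntegrable; fun_prop)
      (by apply Continuous.intervalIntegrable; fun_prop), ih, ih]
    have e1 : (((l + 2 : ℕ) : ℝ) + 1) / 2 = ((l : ℝ) + 1) / 2 + 1 := by push_cast; ring
    have e2 : (a : ℝ) + ((l + 2 : ℕ) : ℝ) / 2 + 1 = ((a : ℝ) + (l : ℝ) / 2 + 1) + 1 := by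
      push_cast; ring
    have e3 : ((a + 1 : ℕ) : ℝ) + 1 / 2 = ((a : ℝ) + 1 / 2) + 1 := by push_cast; ring
    have e4 : ((a + 1 : ℕ) : ℝ) + (l : ℝ) / 2 + 1 = ((a : ℝ) + (l : ℝ) / 2 + 1) + 1 := by
      push_cast; ring
    have h0 : Real.Gamma ((a : ℝ) + (l : ℝ) / 2 + 1) ≠ 0 :=
      (Real.Gamma_pos_of_pos (by positivity)).ne'
    rw [e1, e2, e3, e4, Real.Gamma_add_one (s := ((l : ℝ) + 1) / 2) (by positivity),
      Real.Gamma_add_one (s := (a : ℝ) + (l : ℝ) / 2 + 1) (by positivity),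
      Real.Gamma_add_one (s := (a : ℝ) + 1 / 2) (by positivity)]
    field_simp
    ring

lemma integral_cos_pow_odd_mul_sin_pow {j : ℕ} (hj : Odd j) (l : ℕ) :
    ∫ x in (0 : ℝ)..Real.pi, Real.cos x ^ j * Real.sin x ^ l = 0 := by
  have h := intervalIntegral.integral_comp_sub_left (a := 0) (b := Real.pi)
    (fun x => Real.cos x ^ j * Real.sin x ^ l) Real.pi
  simp only [Real.cos_pi_sub, Real.sin_pi_sub, hj.neg_pow, neg_mul, sub_self, sub_zero,
    intervalIntegral.integral_neg] at h
  linarith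

lemma integral_cos_pow_mul_sin_pow_two_pi (j l : ℕ) :
    ∫ x in (0 : ℝ)..(2 * Real.pi), Real.cos x ^ j * Real.sin x ^ l =
      (1 + (-1) ^ (j + l)) * ∫ x in (0 : ℝ)..Real.pi, Real.cos x ^ j * Real.sin x ^ l := by
  have hc : ∀ a b : ℝ, IntervalIntegrable (fun x => Real.cos x ^ j * Real.sin x ^ l) volume a b :=
    fun a b => by apply Continuous.intervalIntegrable; fun_prop
  have h := intervalIntegral.integral_comp_add_right (a := 0) (b := Real.pi)
    (fun x => Real.cos x ^ j * Real.sin x ^ l) Real.pi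
  rw [← intervalIntegral.integral_add_adjacent_intervals (hc 0 Real.pi) (hc _ _), add_mul, one_mul,
    two_mul]
  simp only [zero_add] at h ⊢
  rw [← h, ← intervalIntegral.integral_const_mul]
  congr 2
  ext x
  rw [Real.cos_add_pi, Real.sin_add_pi, neg_pow (Real.cos x), neg_pow (Real.sin x), pow_add]
  ring

/-- A sum whose odd terms vanish runs over the even indices. -/
lemma sum_range_two_mul_add_one {f : ℕ → ℝ} (hf : ∀ i, f (2 * i + 1) = 0) (m : ℕ) :
    ∑ j ∈ Finset.range (2 * m + 1), f j = ∑ i ∈ Finset.range (m + 1), f (2 * i) := by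
  induction m with
  | zero => simp
  | succ m ih =>
    rw [Finset.sum_range_succ _ (m + 1), ← ih, show 2 * (m + 1) + 1 = 2 * m + 1 + 1 + 1 by ring,
      Finset.sum_range_succ, Finset.sum_range_succ, hf, add_zero]
    rfl

/-- Legendre's duplication formula at `k + 1 / 2`. -/
lemma factorial_two_mul (k : ℕ) :
    ((2 * k).factorial : ℝ) =
      4 ^ k * k.factorial * Real.Gamma ((k : ℝ) + 1 / 2) / Real.Gamma (1 / 2) := by
  have h := Real.Gamma_mul_Gamma_add_half ((k : ℝ) + 1 / 2)
  have e : (2 : ℝ) * ((k : ℝ) + 1 / 2) = ((2 * k : ℕ) : ℝ) + 1 := by push_cast; ring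
  rw [e, add_assoc, add_halves, Real.Gamma_nat_eq_factorial, Real.Gamma_nat_eq_factorial,
    show (1 : ℝ) - (((2 * k : ℕ) : ℝ) + 1) = -((2 * k : ℕ) : ℝ) by ring,
    Real.rpow_neg (by norm_num), Real.rpow_natCast, pow_mul] at h
  rw [Real.Gamma_one_half_eq]
  have : √Real.pi ≠ 0 := (Real.sqrt_pos.2 Real.pi_pos).ne'
  norm_num at h
  field_simp at h ⊢
  rw [← h]

lemma choose_two_mul_mul_Gamma {m i : ℕ} (hi : i ≤ m) :
    ((2 * m).choose (2 * i) : ℝ) *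
        (Real.Gamma ((i : ℝ) + 1 / 2) * Real.Gamma (((m - i : ℕ) : ℝ) + 1 / 2)) =
      (m.choose i : ℝ) * (Real.Gamma (1 / 2) * Real.Gamma ((m : ℝ) + 1 / 2)) := by
  obtain ⟨k, rfl⟩ := Nat.exists_eq_add_of_le hi
  have h0 : Real.Gamma (1 / 2) ≠ 0 := (Real.Gamma_pos_of_pos (by norm_num)).ne'
  have h1 : Real.Gamma ((i : ℝ) + 1 / 2) ≠ 0 := (Real.Gamma_pos_of_pos (by positivity)).ne'
  have h2 : Real.Gamma ((k : ℝ) + 1 / 2) ≠ 0 := (Real.Gamma_pos_of_pos (by positivity)).ne'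
  rw [Nat.add_sub_cancel_left, mul_add 2 i k, Nat.cast_add_choose, Nat.cast_add_choose,
    ← mul_add 2 i k, factorial_two_mul, factorial_two_mul, factorial_two_mul]
  have := Nat.factorial_ne_zero i
  have := Nat.factorial_ne_zero k
  field_simp
  ring

/-! ### Sequences of convolution type -/

/-- A one-parameter family of sequences `k ↦ P k (p)`, polynomial in the parameter, that satisfies a
first-order difference equation in `p` is of convolution type. -/
theorem eval_add_eq_sum_antidiagonal {P : ℕ → Polynomial ℝ} {l s : ℝ} (h0 : P 0 = 1)
    (hz : ∀ k, (P (k + 1)).eval 0 = 0)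
    (hd : ∀ k p, (P (k + 1)).eval p = (P (k + 1)).eval (p - 1) + l * (P k).eval (p + s))
    (k : ℕ) (p q : ℝ) :
    (P k).eval (p + q) =
      ∑ ij ∈ Finset.HasAntidiagonal.antidiagonal k, (P ij.1).eval p * (P ij.2).eval q := by
  induction k generalizing p q with
  | zero => simp [h0]
  | succ k ih =>
    set D : Polynomial ℝ := (P (k + 1)).comp (Polynomial.X + Polynomial.C q) -
      ∑ ij ∈ Finset.HasAntidiagonal.antidiagonal (k + 1),
        P ij.1 * Polynomial.C ((P ij.2).eval q) with hD
    have hDe : ∀ x, D.eval x = (P (k + 1)).eval (x + q) -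
        ∑ ij ∈ Finset.HasAntidiagonal.antidiagonal (k + 1), (P ij.1).eval x * (P ij.2).eval q := by
      intro x
      simp [hD, Polynomial.eval_finsetSum]
    -- `D` vanishes at `0` and has period `1`, so it has infinitely many zeros
    have hper : ∀ x, D.eval x = D.eval (x - 1) := by
      intro x
      rw [hDe, hDe, Finset.Nat.sum_antidiagonal_succ, Finset.Nat.sum_antidiagonal_succ,
        hd k (x + q),
        show x + q + s = (x + s) + q by ring, ih, Finset.mul_sum]
      simp only [hd _ x, add_mul, Finset.sum_add_distrib, h0, Polynomial.eval_one, mul_assoc,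
        show x + q - 1 = x - 1 + q by ring]
      ring
    have hnat : ∀ N : ℕ, D.eval (N : ℝ) = 0 := by
      intro N
      induction N with
      | zero =>
        rw [hDe, Finset.Nat.sum_antidiagonal_succ]
        simp [h0, hz]
      | succ N ihN => rw [hper]; simpa using ihN
    have hzero : D = 0 := by
      refine Polynomial.eq_zero_of_infinite_isRoot D ?_
      exact (Set.infinite_range_of_injective (Nat.cast_injective (R := ℝ))).mono
        (by rintro _ ⟨N, rfl⟩; exact hnat N)
    have := hDe p
    rw [hzero, Polynomial.eval_zero] at this
    linarith

/-- The generating functions of a family of convolution type are powers of each other. -/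
theorem mk_eval_pow {P : ℕ → Polynomial ℝ} {l s : ℝ} (h0 : P 0 = 1)
    (hz : ∀ k, (P (k + 1)).eval 0 = 0)
    (hd : ∀ k p, (P (k + 1)).eval p = (P (k + 1)).eval (p - 1) + l * (P k).eval (p + s))
    (p : ℝ) (N : ℕ) :
    (PowerSeries.mk fun k => (P k).eval p) ^ N = PowerSeries.mk fun k => (P k).eval (N * p) := by
  induction N with
  | zero =>
    ext k
    cases k <;> simp [h0, hz, PowerSeries.coeff_one]
  | succ N ih =>
    ext k
    rw [pow_succ, ih, PowerSeries.coeff_mul, PowerSeries.coeff_mk, Nat.cast_succ, add_mul, one_mul,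
      eval_add_eq_sum_antidiagonal h0 hz hd]
    simp

/-- The coefficients of `(1 - z)^(-p)`, as polynomials in `p`. -/
noncomputable def negBinomialPoly (k : ℕ) : Polynomial ℝ :=
  Polynomial.C ((k.factorial : ℝ)⁻¹) * ascPochhammer ℝ k

/-- The coefficients of `(2 / (1 + √(1 - z)))^p`, as polynomials in `p`:
`p (p + k + 1) (p + k + 2) ⋯ (p + 2k - 1) / (4^k k!)` for `k ≥ 1`. -/
noncomputable def sqrtPowerPoly : ℕ → Polynomial ℝ
  | 0 => 1
  | k + 1 => Polynomial.C ((4 ^ (k + 1) * (k + 1).factorial : ℝ)⁻¹) * Polynomial.X *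
      (ascPochhammer ℝ k).comp (Polynomial.X + Polynomial.C ((k : ℝ) + 2))

lemma ascPochhammer_succ_eval_left (k : ℕ) (x : ℝ) :
    (ascPochhammer ℝ (k + 1)).eval x = x * (ascPochhammer ℝ k).eval (x + 1) := by
  rw [ascPochhammer_succ_left]
  simp

lemma mk_negBinomialPoly_pow (p : ℝ) (N : ℕ) :
    (PowerSeries.mk fun k => (negBinomialPoly k).eval p) ^ N =
      PowerSeries.mk fun k => (negBinomialPoly k).eval (N * p) := by
  refine mk_eval_pow (l := 1) (s := 0) (by simp [negBinomialPoly]) ?_ ?_ p N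
  · intro k
    simp [negBinomialPoly]
  · intro k x
    have h1 := ascPochhammer_succ_eval_left k (x - 1)
    rw [sub_add_cancel] at h1
    have : (k.factorial : ℝ) ≠ 0 := by positivity
    simp only [negBinomialPoly, Polynomial.eval_mul, Polynomial.eval_C, h1, ascPochhammer_succ_eval,
      Nat.factorial_succ, Nat.cast_mul, Nat.cast_succ, add_zero]
    field_simp
    ring

/-- The difference equation used here is `f ^ p = f ^ (p - 1) + (z / 4) f ^ (p + 1)`, which the
quadratic equation `f = 1 + (z / 4) f ^ 2` of `f = 2 / (1 + √(1 - z))` gives. -/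
lemma mk_sqrtPowerPoly_pow (p : ℝ) (N : ℕ) :
    (PowerSeries.mk fun k => (sqrtPowerPoly k).eval p) ^ N =
      PowerSeries.mk fun k => (sqrtPowerPoly k).eval (N * p) := by
  refine mk_eval_pow (l := 1 / 4) (s := 1) (by simp [sqrtPowerPoly]) ?_ ?_ p N
  · intro k
    simp [sqrtPowerPoly]
  · intro k x
    cases k with
    | zero => simp [sqrtPowerPoly]; ring
    | succ k =>
      have h1 := ascPochhammer_succ_eval_left k (x + k + 2)
      have h2 := ascPochhammer_succ_eval k (x + k + 3)
      have : (k.factorial : ℝ) ≠ 0 := by positivity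
      simp only [sqrtPowerPoly, Polynomial.eval_mul, Polynomial.eval_C, Polynomial.eval_comp,
        Polynomial.eval_add, Polynomial.eval_X, Nat.factorial_succ, Nat.cast_mul, Nat.cast_succ]
      rw [show x - 1 + ((k : ℝ) + 1 + 2) = x + k + 2 by ring,
        show x + ((k : ℝ) + 1 + 2) = x + k + 3 by ring,
        show x + 1 + ((k : ℝ) + 2) = x + k + 3 by ring, h1, h2,
        show x + k + 2 + 1 = x + k + 3 by ring]
      field_simp
      ring

lemma eval_sqrtPowerPoly {p : ℝ} (hp : 0 < p) (k : ℕ) :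
    (sqrtPowerPoly k).eval p =
      p * Real.Gamma (p + 2 * k) / (4 ^ k * k.factorial * Real.Gamma (p + k + 1)) := by
  cases k with
  | zero =>
    have := (Real.Gamma_pos_of_pos hp).ne'
    simp [sqrtPowerPoly, Real.Gamma_add_one hp.ne']
    field_simp
  | succ k =>
    have h := Gamma_add_natCast (x := p + (k + 2)) (by positivity) k
    have h0 : Real.Gamma (p + (k + 2)) ≠ 0 := (Real.Gamma_pos_of_pos (by positivity)).ne'
    have e1 : p + 2 * ((k + 1 : ℕ) : ℝ) = p + (k + 2) + k := by push_cast; ring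
    have e2 : p + ((k + 1 : ℕ) : ℝ) + 1 = p + (k + 2) := by push_cast; ring
    rw [e1, e2, h]
    simp [sqrtPowerPoly]
    field_simp

lemma eval_negBinomialPoly {p : ℝ} (hp : 0 < p) (k : ℕ) :
    (negBinomialPoly k).eval p = Real.Gamma (p + k) / (k.factorial * Real.Gamma p) := by
  have := (Real.Gamma_pos_of_pos hp).ne'
  rw [Gamma_add_natCast hp]
  simp [negBinomialPoly]
  field_simp

/-! ### Moments of the uniform direction -/

/-- The density of the surface measure of the sphere in the angles, without the normalization. -/
noncomputable def angleWeight (d : ℕ) (a : Fin (d - 1) → ℝ) : ℝ :=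
  ∏ j : Fin (d - 1), Real.sin (a j) ^ (d - 2 - (j : ℕ))

lemma abs_direction_apply_le_one (d : ℕ) (a : Fin (d - 1) → ℝ) (i : Fin d) :
    |direction d a i| ≤ 1 := by
  rw [direction, PiLp.toLp_apply, abs_mul, Finset.abs_prod]
  refine mul_le_one₀ (Finset.prod_le_one (fun _ _ => abs_nonneg _) fun j _ => ?_) (abs_nonneg _) ?_
  · split_ifs
    · exact Real.abs_sin_le_one _
    · simp
  · split_ifs
    · exact Real.abs_cos_le_one _
    · simp

lemma continuous_direction (d : ℕ) : Continuous (direction d) := by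
  refine (PiLp.continuous_toLp 2 _).comp (continuous_pi fun i => Continuous.mul ?_ ?_)
  · refine continuous_finsetProd _ fun j _ => ?_
    split_ifs <;> fun_prop
  · split_ifs <;> fun_prop

lemma continuous_angleWeight (d : ℕ) : Continuous (angleWeight d) := by
  unfold angleWeight
  fun_prop

lemma angleBox_eq_pi (d : ℕ) :
    angleBox d = Set.univ.pi fun j : Fin (d - 1) =>
      Set.Icc 0 (if (j : ℕ) + 1 < d - 1 then Real.pi else 2 * Real.pi) := by
  ext a
  rw [Set.mem_univ_pi]
  rfl

lemma isCompact_angleBox (d : ℕ) : IsCompact (angleBox d) := by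
  rw [angleBox_eq_pi]
  exact isCompact_univ_pi fun _ => isCompact_Icc

lemma direction_cons_zero (D : ℕ) (θ : ℝ) (a : Fin (D + 1) → ℝ) :
    direction (D + 3) (Fin.cons θ a : Fin (D + 2) → ℝ) 0 = Real.cos θ := by
  simp [direction]

lemma direction_cons_succ (D : ℕ) (θ : ℝ) (a : Fin (D + 1) → ℝ) (i : Fin (D + 2)) :
    direction (D + 3) (Fin.cons θ a : Fin (D + 2) → ℝ) i.succ =
      Real.sin θ * direction (D + 2) a i := by
  simp only [direction, PiLp.toLp_apply]
  change (∏ j : Fin (D + 1 + 1), _) * _ = Real.sin θ * ((∏ j : Fin (D + 1), _) * _)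
  rw [Fin.prod_univ_succ]
  have h : ((i.succ : Fin (D + 3)) : ℕ) < D + 3 - 1 ↔ (i : ℕ) < D + 2 - 1 := by
    rw [Fin.val_succ]; omega
  simp only [Fin.val_succ, Fin.val_zero, Nat.succ_pos, Nat.add_lt_add_iff_right, if_true,
    Fin.cons_zero, Fin.cons_succ]
  rw [mul_assoc]
  congr 2
  by_cases hi : (i : ℕ) < D + 2 - 1
  · rw [dif_pos hi, dif_pos (by omega)]
    congr 1
  · rw [dif_neg hi, dif_neg (by omega)]

lemma angleWeight_cons (D : ℕ) (θ : ℝ) (a : Fin (D + 1) → ℝ) :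
    angleWeight (D + 3) (Fin.cons θ a : Fin (D + 2) → ℝ) =
      Real.sin θ ^ (D + 1) * angleWeight (D + 2) a := by
  simp only [angleWeight]
  change ∏ j : Fin (D + 1 + 1), _ = _ * ∏ j : Fin (D + 1), _
  rw [Fin.prod_univ_succ]
  congr 1
  refine Finset.prod_congr rfl fun j _ => ?_
  rw [Fin.cons_succ, Fin.val_succ]
  congr 1
  omega

lemma cons_mem_angleBox (D : ℕ) (θ : ℝ) (a : Fin (D + 1) → ℝ) :
    (Fin.cons θ a : Fin (D + 2) → ℝ) ∈ angleBox (D + 3) ↔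
      θ ∈ Set.Icc 0 Real.pi ∧ a ∈ angleBox (D + 2) := by
  simp only [angleBox]
  change (∀ j : Fin (D + 1 + 1), _) ↔ _ ∧ ∀ j : Fin (D + 1), _
  rw [Fin.forall_fin_succ]
  simp

/-- The combinatorial step of the recursion on the dimension: moments that are beta integrals in
`j` and `k` recombine through the binomial theorem. -/
lemma sum_choose_mul_even {A : ℕ → ℕ → ℝ} {c h ρ : ℝ} (hj : ∀ j k, Odd j → A j k = 0)
    (hA : ∀ a b, A (2 * a) (2 * b) = c * Real.Gamma ((a : ℝ) + 1 / 2) *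
      Real.Gamma ((b : ℝ) + 1 / 2) * ρ ^ b / Real.Gamma ((a : ℝ) + b + h)) (x : ℝ) (m : ℕ) :
    ∑ j ∈ Finset.range (2 * m + 1), x ^ j * A j (2 * m - j) * ((2 * m).choose j : ℝ) =
      c * Real.Gamma (1 / 2) * Real.Gamma ((m : ℝ) + 1 / 2) / Real.Gamma ((m : ℝ) + h) *
        (x ^ 2 + ρ) ^ m := by
  rw [sum_range_two_mul_add_one (fun i => by rw [hj _ _ (odd_two_mul_add_one i)]; ring), add_pow,
    Finset.mul_sum]
  refine Finset.sum_congr rfl fun i hi => ?_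
  have hi' : i ≤ m := Nat.lt_succ_iff.1 (Finset.mem_range.1 hi)
  have e := choose_two_mul_mul_Gamma hi'
  rw [← Nat.mul_sub, hA, Nat.cast_sub hi', add_sub_cancel]
  rw [Nat.cast_sub hi'] at e
  rw [show x ^ (2 * i) * (c * Real.Gamma ((i : ℝ) + 1 / 2) * Real.Gamma ((m : ℝ) - i + 1 / 2) *
      ρ ^ (m - i) / Real.Gamma ((m : ℝ) + h)) * ((2 * m).choose (2 * i) : ℝ) =
      x ^ (2 * i) * ρ ^ (m - i) * c / Real.Gamma ((m : ℝ) + h) * (((2 * m).choose (2 * i) : ℝ) *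
        (Real.Gamma ((i : ℝ) + 1 / 2) * Real.Gamma ((m : ℝ) - i + 1 / 2))) by ring, e]
  ring

lemma sum_choose_mul_odd {A : ℕ → ℕ → ℝ} (hj : ∀ j k, Odd j → A j k = 0)
    (hk : ∀ j k, Odd k → A j k = 0) (x : ℝ) {N : ℕ} (hN : Odd N) :
    ∑ j ∈ Finset.range (N + 1), x ^ j * A j (N - j) * (N.choose j : ℝ) = 0 := by
  refine Finset.sum_eq_zero fun j hjN => ?_
  have hjN' : j ≤ N := Nat.lt_succ_iff.1 (Finset.mem_range.1 hjN)
  rcases Nat.even_or_odd j with he | ho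
  · rw [hk j _ (Nat.Odd.sub_even hjN' hN he)]; ring
  · rw [hj j _ ho]; ring

lemma setIntegral_angleBox_two (x : Fin 2 → ℝ) (N : ℕ) :
    ∫ a in angleBox 2, (∑ i, x i * direction 2 a i) ^ N * angleWeight 2 a =
      ∑ j ∈ Finset.range (N + 1), x 0 ^ j * (x 1 ^ (N - j) * ∫ φ in (0 : ℝ)..(2 * Real.pi),
        Real.cos φ ^ j * Real.sin φ ^ (N - j)) * (N.choose j : ℝ) := by
  have hpre : (MeasurableEquiv.funUnique (Fin 1) ℝ).symm ⁻¹' (angleBox 2) =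
      Set.Icc 0 (2 * Real.pi) := by
    ext φ
    simp [angleBox, MeasurableEquiv.funUnique]
  have h := ((volume_preserving_funUnique (Fin 1) ℝ).symm).setIntegral_preimage_emb
    (MeasurableEquiv.measurableEmbedding _)
    (fun a => (∑ i, x i * direction 2 a i) ^ N * angleWeight 2 a) (angleBox 2)
  refine h.symm.trans ?_
  rw [hpre, integral_Icc_eq_integral_Ioc, ← intervalIntegral.integral_of_le (by positivity)]
  have e : ∀ φ : ℝ, (∑ i, x i * direction 2 ((MeasurableEquiv.funUnique (Fin 1) ℝ).symm φ) i) ^ N *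
      angleWeight 2 ((MeasurableEquiv.funUnique (Fin 1) ℝ).symm φ) =
      ∑ j ∈ Finset.range (N + 1), x 0 ^ j * (x 1 ^ (N - j) *
        (Real.cos φ ^ j * Real.sin φ ^ (N - j))) * (N.choose j : ℝ) := by
    intro φ
    have : (∑ i, x i * direction 2 ((MeasurableEquiv.funUnique (Fin 1) ℝ).symm φ) i) =
        x 0 * Real.cos φ + x 1 * Real.sin φ := by
      simp [direction, MeasurableEquiv.funUnique]
    rw [this, add_pow]
    simp only [angleWeight, mul_pow]
    simp
    exact Finset.sum_congr rfl fun j _ => by ring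
  simp only [e]
  rw [intervalIntegral.integral_finsetSum
    fun j _ => by apply Continuous.intervalIntegrable; fun_prop]
  simp only [intervalIntegral.integral_mul_const, intervalIntegral.integral_const_mul]

/-- The direction in dimension `D + 3` is `(cos θ, sin θ • U)` with `U` a direction in dimension
`D + 2`, and the weight acquires the factor `sin θ ^ (D + 1)`; the binomial theorem separates `θ`
from the remaining angles. -/
lemma setIntegral_angleBox_succ (D : ℕ) (x : Fin (D + 3) → ℝ) (N : ℕ) :
    ∫ a in angleBox (D + 3), (∑ i, x i * direction (D + 3) a i) ^ N * angleWeight (D + 3) a =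
      ∑ j ∈ Finset.range (N + 1), x 0 ^ j *
        ((∫ θ in (0 : ℝ)..Real.pi, Real.cos θ ^ j * Real.sin θ ^ (N - j + (D + 1))) *
        ∫ a in angleBox (D + 2), (∑ i, x i.succ * direction (D + 2) a i) ^ (N - j) *
          angleWeight (D + 2) a) * (N.choose j : ℝ) := by
  set e := (MeasurableEquiv.piFinSuccAbove (fun _ : Fin (D + 2) => ℝ) 0).symm with he
  have hcons : ∀ z, e z = (Fin.cons z.1 z.2 : Fin (D + 2) → ℝ) := by
    intro z
    simp [he, MeasurableEquiv.piFinSuccAbove, Fin.consEquiv]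
  have hpre : e ⁻¹' (angleBox (D + 3)) = Set.Icc 0 Real.pi ×ˢ angleBox (D + 2) := by
    ext z
    rw [Set.mem_preimage, hcons, cons_mem_angleBox, Set.mem_prod]
  have h := ((volume_preserving_piFinSuccAbove (fun _ : Fin (D + 2) => ℝ) 0).symm
    ).setIntegral_preimage_emb (MeasurableEquiv.measurableEmbedding _)
    (fun a => (∑ i, x i * direction (D + 3) a i) ^ N * angleWeight (D + 3) a) (angleBox (D + 3))
  rw [← he, hpre] at h
  refine h.symm.trans ?_
  have e : ∀ z, (∑ i, x i * direction (D + 3) (e z) i) ^ N * angleWeight (D + 3) (e z) =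
      ∑ j ∈ Finset.range (N + 1), x 0 ^ j * ((Real.cos z.1 ^ j * Real.sin z.1 ^ (N - j + (D + 1))) *
        ((∑ i, x i.succ * direction (D + 2) z.2 i) ^ (N - j) * angleWeight (D + 2) z.2)) *
        (N.choose j : ℝ) := by
    intro z
    have : ∑ i, x i * direction (D + 3) (e z) i = x 0 * Real.cos z.1 +
        Real.sin z.1 * ∑ i, x i.succ * direction (D + 2) z.2 i := by
      rw [hcons, Fin.sum_univ_succ, direction_cons_zero, Finset.mul_sum]
      congr 1
      refine Finset.sum_congr rfl fun i _ => ?_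
      rw [direction_cons_succ]
      ring
    rw [this, hcons, angleWeight_cons, add_pow, Finset.sum_mul]
    refine Finset.sum_congr rfl fun j _ => ?_
    rw [mul_pow, mul_pow, pow_add]
    ring
  simp only [e]
  have hint : ∀ j, IntegrableOn (fun z : ℝ × (Fin (D + 1) → ℝ) =>
      x 0 ^ j * ((Real.cos z.1 ^ j * Real.sin z.1 ^ (N - j + (D + 1))) *
        ((∑ i, x i.succ * direction (D + 2) z.2 i) ^ (N - j) * angleWeight (D + 2) z.2)) *
        (N.choose j : ℝ)) (Set.Icc 0 Real.pi ×ˢ angleBox (D + 2)) := by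
    intro j
    refine ContinuousOn.integrableOn_compact (isCompact_Icc.prod (isCompact_angleBox (D + 2)))
      (Continuous.continuousOn ?_)
    have h1 := continuous_angleWeight (D + 2)
    have h2 : ∀ i, Continuous fun a => direction (D + 2) a i := fun i =>
      (EuclideanSpace.proj i).continuous.comp (continuous_direction (D + 2))
    have h3 : Continuous fun z : ℝ × (Fin (D + 1) → ℝ) => angleWeight (D + 2) z.2 :=
      h1.comp continuous_snd
    have h4 : ∀ i, Continuous fun z : ℝ × (Fin (D + 1) → ℝ) => direction (D + 2) z.2 i :=
      fun i => (h2 i).comp continuous_snd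
    fun_prop
  rw [integral_finsetSum _ fun j _ => hint j]
  refine Finset.sum_congr rfl fun j _ => ?_
  rw [integral_mul_const, integral_const_mul, intervalIntegral.integral_of_le Real.pi_pos.le,
    ← integral_Icc_eq_integral_Ioc]
  congr 2
  exact setIntegral_prod_mul (fun θ : ℝ => Real.cos θ ^ j * Real.sin θ ^ (N - j + (D + 1)))
    (fun a : Fin (D + 1) → ℝ => (∑ i, x i.succ * direction (D + 2) a i) ^ (N - j) *
      angleWeight (D + 2) a) _ _

/-- The moments of a linear form over the sphere. The integral is computed in spherical coordinates
by recursion on the dimension; that it depends on `x` through its length only is the rotation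
invariance of the surface measure. -/
theorem setIntegral_angleBox (D : ℕ) (x : Fin (D + 2) → ℝ) :
    (∀ m : ℕ, ∫ a in angleBox (D + 2),
        (∑ i, x i * direction (D + 2) a i) ^ (2 * m) * angleWeight (D + 2) a =
      2 * Real.Gamma (1 / 2) ^ (D + 1) * Real.Gamma ((m : ℝ) + 1 / 2) /
        Real.Gamma ((m : ℝ) + ((D : ℝ) + 2) / 2) * (∑ i, x i ^ 2) ^ m) ∧
    ∀ N : ℕ, Odd N → ∫ a in angleBox (D + 2),
      (∑ i, x i * direction (D + 2) a i) ^ N * angleWeight (D + 2) a = 0 := by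
  induction D with
  | zero =>
    have hj : ∀ j k : ℕ, Odd j → x 1 ^ k * ∫ φ in (0 : ℝ)..(2 * Real.pi),
        Real.cos φ ^ j * Real.sin φ ^ k = 0 := by
      intro j k h
      rw [integral_cos_pow_mul_sin_pow_two_pi, integral_cos_pow_odd_mul_sin_pow h]
      ring
    have hk : ∀ j k : ℕ, Odd k → x 1 ^ k * ∫ φ in (0 : ℝ)..(2 * Real.pi),
        Real.cos φ ^ j * Real.sin φ ^ k = 0 := by
      intro j k h
      rcases Nat.even_or_odd j with he | ho
      · rw [integral_cos_pow_mul_sin_pow_two_pi, (he.add_odd h).neg_one_pow]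
        ring
      · exact hj j k ho
    constructor
    · intro m
      refine (setIntegral_angleBox_two x (2 * m)).trans ?_
      rw [sum_choose_mul_even (A := fun j k => x 1 ^ k * ∫ φ in (0 : ℝ)..(2 * Real.pi),
        Real.cos φ ^ j * Real.sin φ ^ k) (c := 2) (h := 1) (ρ := x 1 ^ 2) hj]
      · have : ∑ i, x i ^ 2 = x 0 ^ 2 + x 1 ^ 2 := Fin.sum_univ_two _
        rw [this]
        norm_num
      · intro a b
        rw [integral_cos_pow_mul_sin_pow_two_pi, integral_cos_pow_even_mul_sin_pow,
          Even.neg_one_pow (by simp [parity_simps])]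
        push_cast
        rw [mul_div_cancel_left₀ (b : ℝ) two_ne_zero, add_div,
          mul_div_cancel_left₀ (b : ℝ) two_ne_zero]
        ring
    · intro N hN
      refine (setIntegral_angleBox_two x N).trans ?_
      exact sum_choose_mul_odd (A := fun j k => x 1 ^ k * ∫ φ in (0 : ℝ)..(2 * Real.pi),
        Real.cos φ ^ j * Real.sin φ ^ k) hj hk (x 0) hN
  | succ D ih =>
    obtain ⟨ihe, iho⟩ := ih fun i => x i.succ
    set A : ℕ → ℕ → ℝ := fun j k =>
      (∫ θ in (0 : ℝ)..Real.pi, Real.cos θ ^ j * Real.sin θ ^ (k + (D + 1))) *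
        ∫ a in angleBox (D + 2), (∑ i, x i.succ * direction (D + 2) a i) ^ k *
          angleWeight (D + 2) a with hA
    have hj : ∀ j k : ℕ, Odd j → A j k = 0 := by
      intro j k h
      simp only [hA]
      rw [integral_cos_pow_odd_mul_sin_pow h, zero_mul]
    have hk : ∀ j k : ℕ, Odd k → A j k = 0 := by
      intro j k h
      simp only [hA]
      rw [iho k h, mul_zero]
    constructor
    · intro m
      refine (setIntegral_angleBox_succ D x (2 * m)).trans ?_
      refine (sum_choose_mul_even (A := A) (c := 2 * Real.Gamma (1 / 2) ^ (D + 1))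
        (h := ((D + 1 : ℕ) + 2) / 2) (ρ := ∑ i : Fin (D + 2), x i.succ ^ 2) hj ?_ _ m).trans ?_
      · intro a b
        simp only [hA]
        rw [integral_cos_pow_even_mul_sin_pow, ihe]
        have e1 : (((2 * b + (D + 1) : ℕ) : ℝ) + 1) / 2 = b + ((D : ℝ) + 2) / 2 := by
          push_cast; ring
        have e2 : (a : ℝ) + ((2 * b + (D + 1) : ℕ) : ℝ) / 2 + 1 =
            a + b + (((D + 1 : ℕ) : ℝ) + 2) / 2 := by
          push_cast; ring
        have : Real.Gamma (b + ((D : ℝ) + 2) / 2) ≠ 0 :=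
          (Real.Gamma_pos_of_pos (by positivity)).ne'
        rw [e1, e2]
        field_simp
      · have : ∑ i, x i ^ 2 = x 0 ^ 2 + ∑ i : Fin (D + 2), x i.succ ^ 2 := Fin.sum_univ_succ _
        rw [this]
        ring
    · intro N hN
      refine (setIntegral_angleBox_succ D x N).trans ?_
      exact sum_choose_mul_odd (A := A) hj hk (x 0) hN

/-! ### The Dirichlet law of the durations -/

lemma integral_rpow_mul_sub_rpow {a b t : ℝ} (ha : 0 < a) (hb : 0 < b) (ht : 0 < t) :
    ∫ s in (0 : ℝ)..t, s ^ (a - 1) * (t - s) ^ (b - 1) = t ^ (a + b - 1) * beta a b := by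
  apply Complex.ofReal_injective
  rw [← intervalIntegral.integral_ofReal]
  have h := Complex.betaIntegral_scaled (a : ℂ) (b : ℂ) ht
  rw [Complex.betaIntegral_eq_Gamma_mul_div _ _ (by simpa) (by simpa)] at h
  simp_rw [beta]
  push_cast [Complex.ofReal_cpow ht.le]
  rw [← Complex.Gamma_ofReal, ← Complex.Gamma_ofReal, ← Complex.Gamma_ofReal]
  push_cast
  rw [← h]
  refine intervalIntegral.integral_congr fun s hs => ?_
  rw [Set.uIcc_of_le ht.le] at hs
  rw [Complex.ofReal_cpow hs.1, Complex.ofReal_cpow (sub_nonneg.2 hs.2)]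
  push_cast
  rfl

lemma setLIntegral_rpow_mul_sub_rpow {a b t : ℝ} (ha : 0 < a) (hb : 0 < b) (ht : 0 < t) :
    ∫⁻ s in Set.Ioo 0 t, ENNReal.ofReal (s ^ (a - 1) * (t - s) ^ (b - 1)) =
      ENNReal.ofReal (t ^ (a + b - 1) * beta a b) := by
  have h := integral_rpow_mul_sub_rpow ha hb ht
  rw [intervalIntegral.integral_of_le ht.le, integral_Ioc_eq_integral_Ioo] at h
  rw [← h, ofReal_integral_eq_lintegral_ofReal]
  · -- the value of the integral is not zero, so the integrand is integrable
    refine Integrable.of_integral_ne_zero ?_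
    rw [h]
    exact (mul_pos (Real.rpow_pos_of_pos ht _) (beta_pos ha hb)).ne'
  · refine ae_restrict_of_forall_mem measurableSet_Ioo fun s hs => ?_
    exact mul_nonneg (Real.rpow_nonneg hs.1.le _) (Real.rpow_nonneg (sub_nonneg.2 hs.2.le) _)

lemma measurableSet_durationDomain (n : ℕ) (t : ℝ) : MeasurableSet (durationDomain n t) := by
  have : durationDomain n t = (⋂ k, {s | 0 < s k}) ∩ {s | ∑ k, s k < t} := by
    ext s; simp [durationDomain]
  rw [this]
  refine (MeasurableSet.iInter fun k => ?_).inter ?_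
  · exact measurableSet_lt (by fun_prop) (by fun_prop)
  · exact measurableSet_lt (by fun_prop) (by fun_prop)

lemma continuous_durations {n : ℕ} (t : ℝ) (j : Fin (n + 1)) :
    Continuous fun s : Fin n → ℝ => durations t s j := by
  refine Fin.lastCases ?_ (fun i => ?_) j
  · simp only [durations, Fin.snoc_last]
    fun_prop
  · simp only [durations, Fin.snoc_castSucc]
    fun_prop

lemma durations_pos {n : ℕ} {t : ℝ} {s : Fin n → ℝ} (hs : s ∈ durationDomain n t)
    (j : Fin (n + 1)) : 0 < durations t s j := by
  refine Fin.lastCases ?_ (fun i => ?_) j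
  · simpa [durations] using hs.2
  · simpa [durations] using hs.1 i

lemma sum_durations {n : ℕ} (t : ℝ) (s : Fin n → ℝ) : ∑ j, durations t s j = t := by
  rw [Fin.sum_univ_castSucc]
  simp [durations]

lemma durations_cons {n : ℕ} (t u : ℝ) (s : Fin n → ℝ) :
    durations t (Fin.cons u s : Fin (n + 1) → ℝ) = Fin.cons u (durations (t - u) s) := by
  rw [durations, durations, Fin.cons_snoc_eq_snoc_cons, Fin.sum_cons, sub_sub]

lemma cons_mem_durationDomain {n : ℕ} (t u : ℝ) (s : Fin n → ℝ) :
    (Fin.cons u s : Fin (n + 1) → ℝ) ∈ durationDomain (n + 1) t ↔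
      u ∈ Set.Ioo 0 t ∧ s ∈ durationDomain n (t - u) := by
  simp only [durationDomain, Set.mem_ofPred_eq, Fin.forall_fin_succ, Fin.cons_zero, Fin.cons_succ,
    Fin.sum_cons, Set.mem_Ioo, lt_sub_iff_add_lt']
  constructor
  · rintro ⟨⟨h0, h⟩, hs⟩
    exact ⟨⟨h0, lt_of_le_of_lt (le_add_of_nonneg_right
      (Finset.sum_nonneg fun k _ => (h k).le)) hs⟩, h, hs⟩
  · rintro ⟨⟨h0, -⟩, h, hs⟩
    exact ⟨⟨h0, h⟩, hs⟩

/-- **Dirichlet's integral** over the simplex, by induction on the number of variables. -/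
theorem setLIntegral_durationDomain (n : ℕ) (a : Fin (n + 1) → ℝ) (ha : ∀ j, 0 < a j) {t : ℝ}
    (ht : 0 < t) :
    ∫⁻ s in durationDomain n t, ENNReal.ofReal (∏ j, durations t s j ^ (a j - 1)) =
      ENNReal.ofReal (t ^ (∑ j, a j - 1) * ((∏ j, Real.Gamma (a j)) / Real.Gamma (∑ j, a j))) := by
  induction n generalizing t with
  | zero =>
    have h : durationDomain 0 t = Set.univ := by
      ext s; simp [durationDomain, ht]
    have hs : ∀ s : Fin 0 → ℝ, durations t s 0 = t := fun s => by simpa using sum_durations t s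
    have hv : (volume : Measure (Fin 0 → ℝ)) Set.univ = 1 := by
      rw [volume_pi, Measure.pi_univ]; simp
    rw [h, Measure.restrict_univ]
    simp [hs, hv, (Real.Gamma_pos_of_pos (ha 0)).ne', div_self]
  | succ n ih =>
    set A := ∑ j : Fin (n + 1), a j.succ with hA
    set G := ∏ j : Fin (n + 1), Real.Gamma (a j.succ) with hG
    have hApos : 0 < A := Finset.sum_pos (fun j _ => ha j.succ) Finset.univ_nonempty
    have hGpos : 0 < G := Finset.prod_pos fun j _ => Real.Gamma_pos_of_pos (ha j.succ)
    set e := (MeasurableEquiv.piFinSuccAbove (fun _ : Fin (n + 1) => ℝ) 0).symm with he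
    have hcons : ∀ z, e z = (Fin.cons z.1 z.2 : Fin (n + 1) → ℝ) := by
      intro z
      simp [he, MeasurableEquiv.piFinSuccAbove, Fin.consEquiv]
    rw [← lintegral_indicator (measurableSet_durationDomain _ _),
      ← ((volume_preserving_piFinSuccAbove (fun _ : Fin (n + 1) => ℝ) 0).symm).lintegral_comp_emb
      (MeasurableEquiv.measurableEmbedding _), ← he, Measure.volume_eq_prod, lintegral_prod]
    swap
    · refine (Measurable.comp (Measurable.indicator ?_ (measurableSet_durationDomain _ _))
        e.measurable).aemeasurable
      refine ENNReal.measurable_ofReal.comp (Finset.measurable_fun_prod _ fun j _ => ?_)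
      exact (continuous_durations t j).measurable.pow_const _
    have hin : ∀ u : ℝ, ∫⁻ s, (durationDomain (n + 1) t).indicator
        (fun s => ENNReal.ofReal (∏ j, durations t s j ^ (a j - 1))) (e (u, s)) =
        (Set.Ioo 0 t).indicator (fun u => ENNReal.ofReal (G / Real.Gamma A) *
          ENNReal.ofReal (u ^ (a 0 - 1) * (t - u) ^ (A - 1))) u := by
      intro u
      by_cases hu : u ∈ Set.Ioo 0 t
      · rw [Set.indicator_of_mem hu]
        have : ∀ s : Fin n → ℝ, (durationDomain (n + 1) t).indicator
            (fun s => ENNReal.ofReal (∏ j, durations t s j ^ (a j - 1))) (e (u, s)) =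
            ENNReal.ofReal (u ^ (a 0 - 1)) * (durationDomain n (t - u)).indicator
              (fun s => ENNReal.ofReal (∏ j, durations (t - u) s j ^ (a j.succ - 1))) s := by
          intro s
          rw [hcons]
          by_cases hs : s ∈ durationDomain n (t - u)
          · rw [Set.indicator_of_mem ((cons_mem_durationDomain t u s).2 ⟨hu, hs⟩),
              Set.indicator_of_mem hs, Fin.prod_univ_succ, durations_cons,
              ENNReal.ofReal_mul (by exact Real.rpow_nonneg hu.1.le _)]
            simp
          · rw [Set.indicator_of_notMem fun h => hs ((cons_mem_durationDomain t u s).1 h).2,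
              Set.indicator_of_notMem hs, mul_zero]
        simp_rw [this]
        rw [lintegral_const_mul' _ _ ENNReal.ofReal_ne_top,
          lintegral_indicator (measurableSet_durationDomain _ _),
          ih (fun j => a j.succ) (fun j => ha j.succ) (sub_pos.2 hu.2),
          ← ENNReal.ofReal_mul (Real.rpow_nonneg hu.1.le _),
          ← ENNReal.ofReal_mul (div_nonneg hGpos.le (Real.Gamma_pos_of_pos hApos).le)]
        congr 1
        ring
      · rw [Set.indicator_of_notMem hu]
        refine (lintegral_congr fun s => ?_).trans lintegral_zero
        rw [hcons, Set.indicator_of_notMem fun h => hu ((cons_mem_durationDomain t u s).1 h).1]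
    simp_rw [hin]
    rw [lintegral_indicator measurableSet_Ioo, lintegral_const_mul' _ _ ENNReal.ofReal_ne_top,
      setLIntegral_rpow_mul_sub_rpow (ha 0) hApos ht,
      ← ENNReal.ofReal_mul (div_nonneg hGpos.le (Real.Gamma_pos_of_pos hApos).le), beta,
      Fin.sum_univ_succ, Fin.prod_univ_succ, ← hA, ← hG]
    congr 1
    have := (Real.Gamma_pos_of_pos hApos).ne'
    field_simp

lemma measurable_durationDensity (n : ℕ) (q t : ℝ) : Measurable (durationDensity n q t) := by
  unfold durationDensity
  refine measurable_const.mul (Finset.measurable_fun_prod _ fun j _ => ?_)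
  exact (continuous_durations t j).measurable.pow_const _

lemma ae_durationLaw_mem (n : ℕ) (q t : ℝ) : ∀ᵐ s ∂durationLaw n q t, s ∈ durationDomain n t := by
  have h : durationLaw n q t ≪ volume.restrict (durationDomain n t) :=
    withDensity_absolutelyContinuous _ _
  exact h.ae_le (ae_restrict_mem (measurableSet_durationDomain n t))

/-- The mixed moments of the Dirichlet distribution. -/
theorem integral_prod_durations_pow (n : ℕ) {q t : ℝ} (hq : 0 < q) (ht : 0 < t)
    (k : Fin (n + 1) → ℕ) :
    ∫ s, ∏ j, durations t s j ^ k j ∂durationLaw n q t =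
      Real.Gamma ((n + 1) * q) / Real.Gamma ((n + 1) * q + ∑ j, (k j : ℝ)) *
        t ^ (∑ j, k j) * ∏ j, Real.Gamma (q + k j) / Real.Gamma q := by
  have hN : 0 < ((n : ℝ) + 1) * q := by positivity
  have hG := Real.Gamma_pos_of_pos hN
  have hGq := Real.Gamma_pos_of_pos hq
  have hGN : 0 < Real.Gamma ((n + 1) * q + ∑ j, (k j : ℝ)) :=
    Real.Gamma_pos_of_pos (by positivity)
  set C : ℝ := Real.Gamma (((n : ℝ) + 1) * q) / Real.Gamma q ^ (n + 1) *
    (1 / t ^ (((n : ℝ) + 1) * q - 1)) with hC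
  have hCpos : 0 < C := by positivity
  have hm : Measurable fun s : Fin n → ℝ => ∏ j, durations t s j ^ k j :=
    Finset.measurable_fun_prod _ fun j _ => (continuous_durations t j).measurable.pow_const _
  rw [integral_eq_lintegral_of_nonneg_ae _ hm.aestronglyMeasurable]
  swap
  · filter_upwards [ae_durationLaw_mem n q t] with s hs
    exact Finset.prod_nonneg fun j _ => pow_nonneg (durations_pos hs j).le _
  rw [durationLaw, lintegral_withDensity_eq_lintegral_mul _
    (measurable_durationDensity n q t).ennreal_ofReal hm.ennreal_ofReal]
  have hcongr : ∫⁻ s in durationDomain n t, ((fun s => ENNReal.ofReal (durationDensity n q t s)) *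
      fun s => ENNReal.ofReal (∏ j, durations t s j ^ k j)) s =
      ∫⁻ s in durationDomain n t, ENNReal.ofReal C *
        ENNReal.ofReal (∏ j, durations t s j ^ (q + k j - 1)) := by
    refine setLIntegral_congr_fun (measurableSet_durationDomain n t) fun s hs => ?_
    simp only [Pi.mul_apply]
    have hnn : 0 ≤ durationDensity n q t s :=
      mul_nonneg hCpos.le (Finset.prod_nonneg fun j _ => Real.rpow_nonneg (durations_pos hs j).le _)
    rw [← ENNReal.ofReal_mul hnn, ← ENNReal.ofReal_mul hCpos.le, durationDensity, mul_assoc,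
      ← Finset.prod_mul_distrib, ← hC]
    congr 2
    refine Finset.prod_congr rfl fun j _ => ?_
    rw [← Real.rpow_natCast, ← Real.rpow_add (durations_pos hs j)]
    congr 1
    ring
  rw [hcongr, lintegral_const_mul' _ _ ENNReal.ofReal_ne_top,
    setLIntegral_durationDomain n (fun j => q + k j) (fun j => by positivity) ht,
    ← ENNReal.ofReal_mul hCpos.le, ENNReal.toReal_ofReal]
  swap
  · have : 0 < Real.Gamma (∑ j : Fin (n + 1), (q + k j : ℝ)) :=
      Real.Gamma_pos_of_pos (Finset.sum_pos (fun j _ => by positivity) Finset.univ_nonempty)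
    have : ∀ j, 0 < Real.Gamma (q + k j) := fun j => Real.Gamma_pos_of_pos (by positivity)
    have : 0 ≤ ∏ j, Real.Gamma (q + k j) := Finset.prod_nonneg fun j _ => (this j).le
    positivity
  have hsum : ∑ j : Fin (n + 1), (q + k j : ℝ) = (n + 1) * q + ∑ j, (k j : ℝ) := by
    rw [Finset.sum_add_distrib]
    simp
  have hpow : t ^ ((n + 1) * q + ∑ j, (k j : ℝ) - 1) =
      t ^ (((n : ℝ) + 1) * q - 1) * t ^ (∑ j, k j) := by
    rw [← Real.rpow_natCast, ← Real.rpow_add ht]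
    push_cast
    congr 1
    ring
  have h0 := Real.rpow_pos_of_pos ht (((n : ℝ) + 1) * q - 1)
  rw [hsum, hpow, Finset.prod_div_distrib, hC]
  simp only [Finset.prod_const, Finset.card_univ, Fintype.card_fin]
  field_simp

/-! ### Reduction to a generating function -/

lemma sum_direction_sq (D : ℕ) (a : Fin (D + 1) → ℝ) : ∑ i, direction (D + 2) a i ^ 2 = 1 := by
  induction D with
  | zero =>
    have : ∑ i, direction 2 a i ^ 2 = direction 2 a 0 ^ 2 + direction 2 a 1 ^ 2 :=
      Fin.sum_univ_two _
    refine this.trans ?_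
    simp [direction]
  | succ D ih =>
    obtain ⟨θ, a, rfl⟩ : ∃ θ, ∃ a' : Fin (D + 1) → ℝ, a = Fin.cons θ a' :=
      ⟨a 0, Fin.tail a, (Fin.cons_self_tail a).symm⟩
    refine (Fin.sum_univ_succ (n := D + 2) _).trans ?_
    simp only [direction_cons_zero, direction_cons_succ, mul_pow, ← Finset.mul_sum, ih a]
    linarith [Real.sin_sq_add_cos_sq θ]

lemma norm_direction (D : ℕ) (a : Fin (D + 1) → ℝ) : ‖direction (D + 2) a‖ = 1 := by
  have h := EuclideanSpace.real_norm_sq_eq (direction (D + 2) a)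
  rw [sum_direction_sq] at h
  exact (pow_eq_one_iff_of_nonneg (norm_nonneg _) two_ne_zero).1 h

/-- The moment of order `2m` of a coordinate of a uniform point of the unit sphere of `ℝ^d`. -/
noncomputable def sphereMoment (d m : ℕ) : ℝ :=
  Real.Gamma ((m : ℝ) + 1 / 2) * Real.Gamma ((d : ℝ) / 2) /
    (Real.Gamma (1 / 2) * Real.Gamma ((m : ℝ) + (d : ℝ) / 2))

lemma sphereMoment_pos {d : ℕ} (hd : 0 < d) (m : ℕ) : 0 < sphereMoment d m := by
  have : (0 : ℝ) < d := by exact_mod_cast hd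
  have h1 := Real.Gamma_pos_of_pos (s := (m : ℝ) + 1 / 2) (by positivity)
  have h2 := Real.Gamma_pos_of_pos (s := (d : ℝ) / 2) (by positivity)
  have h3 := Real.Gamma_pos_of_pos (s := (1 : ℝ) / 2) (by positivity)
  have h4 := Real.Gamma_pos_of_pos (s := (m : ℝ) + (d : ℝ) / 2) (by positivity)
  unfold sphereMoment
  positivity

/-- The last angle `φ` ranges over `[0, 2π]`, but its sine has exponent `0`. -/
lemma angleWeight_nonneg {d : ℕ} {a : Fin (d - 1) → ℝ} (ha : a ∈ angleBox d) :
    0 ≤ angleWeight d a := by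
  refine Finset.prod_nonneg fun j _ => ?_
  by_cases hj : (j : ℕ) + 1 < d - 1
  · have h := ha j
    rw [if_pos hj] at h
    exact pow_nonneg (Real.sin_nonneg_of_nonneg_of_le_pi h.1 h.2) _
  · have : d - 2 - (j : ℕ) = 0 := by omega
    rw [this, pow_zero]
    exact zero_le_one

lemma integral_angleLaw {d : ℕ} (hd : 0 < d) (f : (Fin (d - 1) → ℝ) → ℝ) :
    ∫ a, f a ∂angleLaw d = Real.Gamma ((d : ℝ) / 2) / (2 * Real.pi ^ ((d : ℝ) / 2)) *
      ∫ a in angleBox d, f a * angleWeight d a := by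
  have hd' : (0 : ℝ) < d := by exact_mod_cast hd
  have hC : 0 ≤ Real.Gamma ((d : ℝ) / 2) / (2 * Real.pi ^ ((d : ℝ) / 2)) := by
    have := Real.Gamma_pos_of_pos (s := (d : ℝ) / 2) (by positivity)
    positivity
  have hm : Measurable (angleDensity d) := (continuous_angleWeight d).measurable.const_mul _
  rw [angleLaw, integral_withDensity_eq_integral_toReal_smul hm.ennreal_ofReal
    (Filter.Eventually.of_forall fun _ => ENNReal.ofReal_lt_top), ← integral_const_mul]
  refine setIntegral_congr_fun (isCompact_angleBox d).measurableSet fun a ha => ?_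
  simp only [smul_eq_mul]
  rw [ENNReal.toReal_ofReal (by exact mul_nonneg hC (angleWeight_nonneg ha))]
  change _ * angleWeight d a * f a = _
  ring

lemma integral_angleLaw_even (D : ℕ) (x : Fin (D + 2) → ℝ) (m : ℕ) :
    ∫ a, (∑ i, x i * direction (D + 2) a i) ^ (2 * m) ∂angleLaw (D + 2) =
      sphereMoment (D + 2) m * (∑ i, x i ^ 2) ^ m := by
  have hpi : Real.pi ^ (((D + 2 : ℕ) : ℝ) / 2) = Real.Gamma (1 / 2) ^ (D + 2) := by
    rw [Real.Gamma_one_half_eq, Real.sqrt_eq_rpow, ← Real.rpow_mul_natCast Real.pi_pos.le]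
    congr 1
    ring
  have h0 := (Real.Gamma_pos_of_pos (s := (1 : ℝ) / 2) (by positivity)).ne'
  have h1 := (Real.Gamma_pos_of_pos (s := (m : ℝ) + ((D : ℝ) + 2) / 2) (by positivity)).ne'
  rw [integral_angleLaw (by omega), (setIntegral_angleBox D x).1 m, hpi, sphereMoment]
  push_cast
  field_simp
  ring

lemma integral_angleLaw_odd (D : ℕ) (x : Fin (D + 2) → ℝ) {N : ℕ} (hN : Odd N) :
    ∫ a, (∑ i, x i * direction (D + 2) a i) ^ N ∂angleLaw (D + 2) = 0 := by
  rw [integral_angleLaw (by omega), (setIntegral_angleBox D x).2 N hN, mul_zero]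

lemma sum_finsuppAntidiag_eq_sum_piAntidiag {ι : Type*} [Fintype ι] [DecidableEq ι] (N : ℕ)
    (f : (ι → ℕ) → ℝ) :
    ∑ l ∈ Finset.finsuppAntidiag (Finset.univ : Finset ι) N, f l =
      ∑ k ∈ Finset.piAntidiag (Finset.univ : Finset ι) N, f k := by
  refine Finset.sum_nbij' (fun l => l) (fun k => Finsupp.equivFunOnFinite.symm k) ?_ ?_ ?_ ?_ ?_
  · intro l hl
    simpa using (Finset.mem_finsuppAntidiag.1 hl).1
  · intro k hk
    simpa [Finset.mem_finsuppAntidiag] using hk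
  · intro l _
    ext i
    rfl
  · intro k _
    rfl
  · intro l _
    rfl

lemma coeff_pow_eq_sum_piAntidiag (f : ℕ → ℝ) (n N : ℕ) :
    PowerSeries.coeff N ((PowerSeries.mk f) ^ (n + 1)) =
      ∑ k ∈ Finset.piAntidiag (Finset.univ : Finset (Fin (n + 1))) N, ∏ j, f (k j) := by
  rw [← sum_finsuppAntidiag_eq_sum_piAntidiag N fun k => ∏ j, f (k j)]
  have := PowerSeries.coeff_prod (fun _ : Fin (n + 1) => PowerSeries.mk f) N Finset.univ
  rw [Finset.prod_const, Finset.card_univ, Fintype.card_fin] at this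
  simpa using this

section Flight

variable {Ω : Type*} [MeasurableSpace Ω] {P : Measure Ω}

lemma IsFlight.ae_mem {d n : ℕ} {q t : ℝ} {τ : Ω → Fin n → ℝ}
    {θ : Fin (n + 1) → Ω → Fin (d - 1) → ℝ} (h : IsFlight P d n q t τ θ) :
    ∀ᵐ ω ∂P, τ ω ∈ durationDomain n t := by
  have := ae_durationLaw_mem n q t
  rw [← h.hasLaw_durations.map_eq] at this
  exact ae_of_ae_map h.hasLaw_durations.aemeasurable this

lemma durations_le {n : ℕ} {t : ℝ} {s : Fin n → ℝ} (hs : s ∈ durationDomain n t)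
    (j : Fin (n + 1)) : durations t s j ≤ t := by
  exact (Finset.single_le_sum (f := fun j => durations t s j)
    (fun i _ => (durations_pos hs i).le) (Finset.mem_univ j)).trans_eq (sum_durations t s)

lemma continuous_sum_mul_direction (d : ℕ) (x : Fin d → ℝ) :
    Continuous fun a => ∑ i, x i * direction d a i := by
  have : ∀ i, Continuous fun a => direction d a i := fun i =>
    (EuclideanSpace.proj i).continuous.comp (continuous_direction d)
  fun_prop

lemma abs_sum_mul_direction_le (d : ℕ) (x : Fin d → ℝ) (a : Fin (d - 1) → ℝ) :
    |∑ i, x i * direction d a i| ≤ ∑ i, |x i| := by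
  refine (Finset.abs_sum_le_sum_abs _ _).trans (Finset.sum_le_sum fun i _ => ?_)
  rw [abs_mul]
  exact mul_le_of_le_one_right (abs_nonneg _) (abs_direction_apply_le_one d a i)

/-- The mixed moments of the durations and of the projections of the directions on `x`. -/
lemma IsFlight.integral_prod {D n : ℕ} {q t : ℝ} {τ : Ω → Fin n → ℝ}
    {θ : Fin (n + 1) → Ω → Fin (D + 2 - 1) → ℝ} (h : IsFlight P (D + 2) n q t τ θ)
    (x : Fin (D + 2) → ℝ) (k : Fin (n + 1) → ℕ) :
    ∫ ω, ∏ j, (durations t (τ ω) j * ∑ i, x i * direction (D + 2) (θ j ω) i) ^ k j ∂P =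
      (∫ s, ∏ j, durations t s j ^ k j ∂durationLaw n q t) *
        ∏ j, ∫ a, (∑ i, x i * direction (D + 2) a i) ^ k j ∂angleLaw (D + 2) := by
  have hf : Measurable fun s : Fin n → ℝ => ∏ j, durations t s j ^ k j :=
    Finset.measurable_fun_prod _ fun j _ => (continuous_durations t j).measurable.pow_const _
  have hg1 : ∀ j, Measurable fun a : Fin (D + 2 - 1) → ℝ =>
      (∑ i, x i * direction (D + 2) a i) ^ k j := fun j =>
    (continuous_sum_mul_direction (D + 2) x).measurable.pow_const _
  have hg : Measurable fun a : Fin (n + 1) → Fin (D + 2 - 1) → ℝ =>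
      ∏ j, (∑ i, x i * direction (D + 2) (a j) i) ^ k j :=
    Finset.measurable_fun_prod _ fun j _ => (hg1 j).comp (measurable_pi_apply j)
  have hθ : AEMeasurable (fun ω j => θ j ω) P :=
    aemeasurable_pi_lambda _ fun j => (h.hasLaw_angles j).aemeasurable
  simp only [mul_pow, Finset.prod_mul_distrib]
  rw [h.indepFun.integral_fun_comp_mul_comp (f := fun s => ∏ j, durations t s j ^ k j)
    (g := fun a : Fin (n + 1) → Fin (D + 2 - 1) → ℝ =>
      ∏ j, (∑ i, x i * direction (D + 2) (a j) i) ^ k j)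
    h.hasLaw_durations.aemeasurable hθ hf.aestronglyMeasurable hg.aestronglyMeasurable]
  congr 1
  · exact h.hasLaw_durations.integral_comp hf.aestronglyMeasurable
  · rw [h.iIndepFun_angles.integral_fun_prod_comp (fun j => (h.hasLaw_angles j).aemeasurable)
      (f := fun j a => (∑ i, x i * direction (D + 2) a i) ^ k j)
      fun j => (hg1 j).aestronglyMeasurable]
    exact Finset.prod_congr rfl fun j _ =>
      (h.hasLaw_angles j).integral_comp (hg1 j).aestronglyMeasurable

/-- The even moments of the projection of the position on a unit vector: the multinomial expansion
and the Dirichlet moments turn them into the coefficients of a power of a generating function. -/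
lemma IsFlight.integral_projection_pow [IsProbabilityMeasure P] {D n : ℕ} {q t : ℝ}
    (hq : 0 < q) (ht : 0 < t)
    {τ : Ω → Fin n → ℝ} {θ : Fin (n + 1) → Ω → Fin (D + 2 - 1) → ℝ}
    (h : IsFlight P (D + 2) n q t τ θ) (x : Fin (D + 2) → ℝ) (hx : ∑ i, x i ^ 2 = 1) (m : ℕ) :
    ∫ ω, (∑ j, durations t (τ ω) j * ∑ i, x i * direction (D + 2) (θ j ω) i) ^ (2 * m) ∂P =
      t ^ (2 * m) * (((2 * m).factorial : ℝ) * Real.Gamma ((n + 1) * q) /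
        Real.Gamma ((n + 1) * q + 2 * m)) * PowerSeries.coeff m
          ((PowerSeries.mk fun k => Real.Gamma (q + 2 * k) / (Real.Gamma q * (2 * k).factorial) *
            sphereMoment (D + 2) k) ^ (n + 1)) := by
  set M : ℕ → ℝ := fun k => ∫ a, (∑ i, x i * direction (D + 2) a i) ^ k ∂angleLaw (D + 2) with hM
  have hMe : ∀ k, M (2 * k) = sphereMoment (D + 2) k := fun k => by
    simp only [hM]
    rw [integral_angleLaw_even, hx, one_pow, mul_one]
  have hMo : ∀ k, Odd k → M k = 0 := fun k hk => integral_angleLaw_odd D x hk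
  -- the odd moments of the projection vanish, so the generating function is even
  have hexp : (PowerSeries.mk fun k => Real.Gamma (q + k) / Real.Gamma q / k.factorial * M k) =
      PowerSeries.expand 2 two_ne_zero (PowerSeries.mk fun k =>
        Real.Gamma (q + 2 * k) / (Real.Gamma q * (2 * k).factorial) * sphereMoment (D + 2) k) := by
    ext k
    rw [PowerSeries.coeff_expand, PowerSeries.coeff_mk]
    rcases Nat.even_or_odd' k with ⟨k, rfl | rfl⟩
    · rw [if_pos (dvd_mul_right 2 k), Nat.mul_div_cancel_left _ two_pos, PowerSeries.coeff_mk, hMe,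
        div_div]
      push_cast
      rfl
    · rw [if_neg (by omega), hMo _ (odd_two_mul_add_one k), mul_zero]
  rw [← PowerSeries.coeff_expand_mul 2 two_ne_zero, map_pow, ← hexp, coeff_pow_eq_sum_piAntidiag,
    Finset.mul_sum]
  simp only [Finset.sum_pow_eq_sum_piAntidiag]
  rw [integral_finsetSum]
  · refine Finset.sum_congr rfl fun k hk => ?_
    have hsum : ∑ j, k j = 2 * m := (Finset.mem_piAntidiag.1 hk).1
    have hsum' : ∑ j, (k j : ℝ) = 2 * m := by exact_mod_cast hsum
    have hmul : (Nat.multinomial Finset.univ k : ℝ) * ∏ j, ((k j).factorial : ℝ) =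
        ((2 * m).factorial : ℝ) := by
      rw [← hsum, ← Nat.multinomial_spec Finset.univ k]
      push_cast
      ring
    rw [integral_const_mul, h.integral_prod, show ∏ j, ∫ a, (∑ i, x i * direction (D + 2) a i) ^ k j
      ∂angleLaw (D + 2) = ∏ j, M (k j) from rfl, integral_prod_durations_pow n hq ht, hsum, hsum',
      Finset.prod_mul_distrib, Finset.prod_div_distrib (g := fun j => ((k j).factorial : ℝ)),
      ← hmul]
    have : ∏ j, ((k j).factorial : ℝ) ≠ 0 :=
      Finset.prod_ne_zero_iff.2 fun j _ => by positivity
    field_simp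
  · intro k _
    refine Integrable.const_mul ?_ _
    refine Integrable.of_bound (C := ∏ j, (t * ∑ i, |x i|) ^ k j) ?_ ?_
    · refine (Finset.aemeasurable_fun_prod _ fun j _ =>
        (AEMeasurable.mul ?_ ?_).pow_const _).aestronglyMeasurable
      · exact (continuous_durations t j).measurable.comp_aemeasurable
          h.hasLaw_durations.aemeasurable
      · exact (continuous_sum_mul_direction (D + 2) x).measurable.comp_aemeasurable
          (h.hasLaw_angles j).aemeasurable
    · filter_upwards [h.ae_mem] with ω hω
      rw [Real.norm_eq_abs, Finset.abs_prod]
      refine Finset.prod_le_prod (fun _ _ => abs_nonneg _) fun j _ => ?_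
      rw [abs_pow, abs_mul, abs_of_pos (durations_pos hω j)]
      have h1 := durations_le hω j
      have h2 := abs_sum_mul_direction_le (D + 2) x (θ j ω)
      have h3 := (durations_pos hω j).le
      gcongr

/-- The position of the flight of unit speed. -/
noncomputable def unitPosition {d n : ℕ} (t : ℝ) (s : Fin n → ℝ)
    (a : Fin (n + 1) → Fin (d - 1) → ℝ) : EuclideanSpace ℝ (Fin d) :=
  ∑ j, durations t s j • direction d (a j)

lemma norm_unitPosition_le {D n : ℕ} {t : ℝ} {s : Fin n → ℝ} (hs : s ∈ durationDomain n t)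
    (a : Fin (n + 1) → Fin (D + 2 - 1) → ℝ) : ‖unitPosition t s a‖ ≤ t := by
  refine (norm_sum_le _ _).trans_eq ?_
  refine (Finset.sum_congr rfl fun j _ => ?_).trans (sum_durations t s)
  rw [norm_smul, norm_direction, mul_one, Real.norm_of_nonneg (durations_pos hs j).le]

lemma IsFlight.aemeasurable_unitPosition {d n : ℕ} {q t : ℝ} {τ : Ω → Fin n → ℝ}
    {θ : Fin (n + 1) → Ω → Fin (d - 1) → ℝ} (h : IsFlight P d n q t τ θ) :
    AEMeasurable (fun ω => unitPosition t (τ ω) fun j => θ j ω) P := by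
  refine Finset.aemeasurable_fun_sum _ fun j _ => AEMeasurable.fun_smul ?_ ?_
  · exact (continuous_durations t j).measurable.comp_aemeasurable
      h.hasLaw_durations.aemeasurable
  · exact (continuous_direction d).measurable.comp_aemeasurable (h.hasLaw_angles j).aemeasurable

/-- The even moments of the distance. Averaging the projection of the position over an independent
uniform direction gives a multiple of the distance, by `integral_angleLaw_even`. -/
theorem IsFlight.integral_norm_pow [IsProbabilityMeasure P] {D n : ℕ} {q t : ℝ}
    (hq : 0 < q) (ht : 0 < t)
    {τ : Ω → Fin n → ℝ} {θ : Fin (n + 1) → Ω → Fin (D + 2 - 1) → ℝ}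
    (h : IsFlight P (D + 2) n q t τ θ) (m : ℕ) :
    sphereMoment (D + 2) m * ∫ ω, (‖unitPosition t (τ ω) fun j => θ j ω‖ ^ 2) ^ m ∂P =
      t ^ (2 * m) * (((2 * m).factorial : ℝ) * Real.Gamma ((n + 1) * q) /
        Real.Gamma ((n + 1) * q + 2 * m)) * PowerSeries.coeff m
          ((PowerSeries.mk fun k => Real.Gamma (q + 2 * k) / (Real.Gamma q * (2 * k).factorial) *
            sphereMoment (D + 2) k) ^ (n + 1)) := by
  set V : Ω → EuclideanSpace ℝ (Fin (D + 2)) := fun ω => unitPosition t (τ ω) fun j => θ j ω with hV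
  have hVm : AEMeasurable V P := h.aemeasurable_unitPosition
  have : IsProbabilityMeasure (angleLaw (D + 2)) :=
    (h.hasLaw_angles 0).isProbabilityMeasure_iff.1 inferInstance
  have hswap : ∀ ω a, ∑ i, V ω i * direction (D + 2) a i =
      ∑ j, durations t (τ ω) j * ∑ i, direction (D + 2) a i * direction (D + 2) (θ j ω) i := by
    intro ω a
    simp only [hV, unitPosition, WithLp.ofLp_sum, WithLp.ofLp_smul, Finset.sum_apply, Pi.smul_apply,
      smul_eq_mul, Finset.sum_mul, Finset.mul_sum]
    rw [Finset.sum_comm]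
    exact Finset.sum_congr rfl fun j _ => Finset.sum_congr rfl fun i _ => by ring
  have hint : Integrable (Function.uncurry fun ω a =>
      (∑ i, V ω i * direction (D + 2) a i) ^ (2 * m)) (P.prod (angleLaw (D + 2))) := by
    refine Integrable.of_bound (C := t ^ (2 * m)) ?_ ?_
    · refine (AEMeasurable.pow_const ?_ _).aestronglyMeasurable
      refine Finset.aemeasurable_fun_sum _ fun i _ => AEMeasurable.mul ?_ ?_
      · exact ((EuclideanSpace.proj (𝕜 := ℝ) i).continuous.measurable.comp_aemeasurable
          hVm).comp_fst
      · exact ((EuclideanSpace.proj (𝕜 := ℝ) i).continuous.comp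
          (continuous_direction (D + 2))).measurable.aemeasurable.comp_snd
    · have := Measure.quasiMeasurePreserving_fst (μ := P) (ν := angleLaw (D + 2))
      filter_upwards [this.ae h.ae_mem] with z hz
      have e : ∑ i, V z.1 i * direction (D + 2) z.2 i =
          inner ℝ (direction (D + 2) z.2) (V z.1) := by
        simp [PiLp.inner_apply]
      rw [Function.uncurry, e, norm_pow]
      refine pow_le_pow_left₀ (norm_nonneg _) ((norm_inner_le_norm _ _).trans ?_) _
      rw [norm_direction, one_mul]
      exact norm_unitPosition_le hz _
  calc
    _ = ∫ ω, ∫ a, (∑ i, V ω i * direction (D + 2) a i) ^ (2 * m) ∂angleLaw (D + 2) ∂P := by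
      rw [← integral_const_mul]
      refine integral_congr_ae (Filter.Eventually.of_forall fun ω => ?_)
      simp only
      rw [integral_angleLaw_even, EuclideanSpace.real_norm_sq_eq]
    _ = ∫ a, ∫ ω, (∑ i, V ω i * direction (D + 2) a i) ^ (2 * m) ∂P ∂angleLaw (D + 2) :=
      integral_integral_swap hint
    _ = _ := by
      simp_rw [hswap, h.integral_projection_pow hq ht _ (sum_direction_sq D _)]
      simp

end Flight

/-! ### Identification of the beta law -/

/-- Two laws on `[0, 1]` with the same moments give the same integrals of continuous functions, by
Weierstrass's approximation theorem. -/
theorem integral_eq_of_moments_eq {μ ν : Measure ℝ} [IsProbabilityMeasure μ]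
    [IsProbabilityMeasure ν] (hμ : ∀ᵐ x ∂μ, x ∈ Set.Icc (0 : ℝ) 1)
    (hν : ∀ᵐ x ∂ν, x ∈ Set.Icc (0 : ℝ) 1) (h : ∀ m : ℕ, ∫ x, x ^ m ∂μ = ∫ x, x ^ m ∂ν)
    {f : ℝ → ℝ} (hf : Continuous f) : ∫ x, f x ∂μ = ∫ x, f x ∂ν := by
  have hint : ∀ {ρ : Measure ℝ} [IsProbabilityMeasure ρ], (∀ᵐ x ∂ρ, x ∈ Set.Icc (0 : ℝ) 1) →
      ∀ {g : ℝ → ℝ}, Continuous g → Integrable g ρ := by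
    intro ρ _ hρ g hg
    obtain ⟨C, hC⟩ :=
      isCompact_Icc.exists_bound_of_continuousOn (hg.continuousOn (s := Set.Icc 0 1))
    exact Integrable.of_bound hg.aestronglyMeasurable C (hρ.mono hC)
  have hpoly : ∀ p : Polynomial ℝ, ∫ x, p.eval x ∂μ = ∫ x, p.eval x ∂ν := by
    intro p
    simp only [Polynomial.eval_eq_sum_range]
    rw [integral_finsetSum _ fun i _ => hint hμ (by fun_prop),
      integral_finsetSum _ fun i _ => hint hν (by fun_prop)]
    simp only [integral_const_mul, h]
  refine eq_of_forall_dist_le fun ε hε => ?_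
  obtain ⟨p, hp⟩ := exists_polynomial_near_of_continuousOn 0 1 f hf.continuousOn
    (ε / 2) (half_pos hε)
  have hdist : ∀ {ρ : Measure ℝ} [IsProbabilityMeasure ρ], (∀ᵐ x ∂ρ, x ∈ Set.Icc (0 : ℝ) 1) →
      dist (∫ x, p.eval x ∂ρ) (∫ x, f x ∂ρ) ≤ ε / 2 := by
    intro ρ _ hρ
    rw [dist_eq_norm, ← integral_sub (hint hρ p.continuous) (hint hρ hf)]
    refine (norm_integral_le_of_norm_le_const (C := ε / 2)
      (hρ.mono fun x hx => (hp x hx).le)).trans ?_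
    simp
  calc dist (∫ x, f x ∂μ) (∫ x, f x ∂ν)
      ≤ dist (∫ x, f x ∂μ) (∫ x, p.eval x ∂μ) + dist (∫ x, p.eval x ∂μ) (∫ x, f x ∂ν) :=
        dist_triangle _ _ _
    _ ≤ ε / 2 + ε / 2 := by
        refine add_le_add ?_ ?_
        · rw [dist_comm]; exact hdist hμ
        · rw [hpoly]; exact hdist hν
    _ = ε := add_halves ε

lemma ae_betaMeasure_mem (α β : ℝ) : ∀ᵐ x ∂betaMeasure α β, x ∈ Set.Icc (0 : ℝ) 1 := by
  have hm : Measurable (betaPDF α β) := (measurable_betaPDFReal α β).ennreal_ofReal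
  rw [betaMeasure, ae_withDensity_iff hm]
  refine Filter.Eventually.of_forall fun x hx => ?_
  by_contra h
  apply hx
  rcases lt_or_ge x 0 with h0 | h0
  · exact betaPDF_eq_zero_of_nonpos h0.le
  · exact betaPDF_eq_zero_of_one_le (not_le.1 fun h1 => h ⟨h0, h1⟩).le

lemma integral_rpow_betaMeasure {α β r : ℝ} (hα : 0 < α) (hβ : 0 < β) (hr : 0 ≤ r) :
    ∫ x, x ^ r ∂betaMeasure α β = beta (α + r) β / beta α β := by
  have h := integral_rpow_mul_sub_rpow (t := 1) (add_pos_of_pos_of_nonneg hα hr) hβ one_pos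
  rw [intervalIntegral.integral_of_le zero_le_one, integral_Ioc_eq_integral_Ioo, Real.one_rpow,
    one_mul] at h
  have hm : Measurable (betaPDF α β) := (measurable_betaPDFReal α β).ennreal_ofReal
  rw [betaMeasure, integral_withDensity_eq_integral_toReal_smul hm
    (Filter.Eventually.of_forall fun _ => ENNReal.ofReal_lt_top), ← h, div_eq_inv_mul,
    ← integral_const_mul, ← integral_indicator measurableSet_Ioo]
  refine integral_congr_ae (Filter.Eventually.of_forall fun x => ?_)
  by_cases hx : x ∈ Set.Ioo (0 : ℝ) 1
  · have h1 := (beta_pos hα hβ).le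
    have h2 := Real.rpow_nonneg hx.1.le (α - 1)
    have h3 := Real.rpow_nonneg (sub_nonneg.2 hx.2.le) (β - 1)
    simp only [smul_eq_mul]
    rw [Set.indicator_of_mem hx, betaPDF_of_pos_lt_one hx.1 hx.2,
      ENNReal.toReal_ofReal (by positivity), show α + r - 1 = (α - 1) + r by ring,
      Real.rpow_add hx.1]
    ring
  · have : betaPDF α β x = 0 := by
      rw [betaPDF_eq, if_neg (by simpa using hx), ENNReal.ofReal_zero]
    simp [this, Set.indicator_of_notMem hx]

/-- A variable in `[0, 1]` with the integer moments of a beta law has its real moments. -/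
theorem integral_rpow_of_moments {Ω : Type*} [MeasurableSpace Ω] {P : Measure Ω}
    [IsProbabilityMeasure P] {Y : Ω → ℝ} (hY : AEMeasurable Y P)
    (hmem : ∀ᵐ ω ∂P, Y ω ∈ Set.Icc (0 : ℝ) 1) {α B : ℝ} (hα : 0 < α) (hB : α < B)
    (hmom : ∀ m : ℕ, ∫ ω, Y ω ^ m ∂P =
      Real.Gamma (α + m) * Real.Gamma B / (Real.Gamma α * Real.Gamma (B + m)))
    {r : ℝ} (hr : 0 ≤ r) :
    ∫ ω, Y ω ^ r ∂P =
      Real.Gamma (α + r) * Real.Gamma B / (Real.Gamma α * Real.Gamma (B + r)) := by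
  have hβ : 0 < B - α := sub_pos.2 hB
  have := isProbabilityMeasureBeta hα hβ
  have := Measure.isProbabilityMeasure_map (μ := P) hY
  have hbeta : ∀ {s : ℝ}, 0 ≤ s → ∫ x, x ^ s ∂betaMeasure α (B - α) =
      Real.Gamma (α + s) * Real.Gamma B / (Real.Gamma α * Real.Gamma (B + s)) := by
    intro s hs
    have h1 := (Real.Gamma_pos_of_pos hβ).ne'
    rw [integral_rpow_betaMeasure hα hβ hs, beta, beta, add_sub_cancel,
      show α + s + (B - α) = B + s by ring]
    have h2 := (Real.Gamma_pos_of_pos hα).ne'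
    have h3 := (Real.Gamma_pos_of_pos (hα.trans hB)).ne'
    have h4 := (Real.Gamma_pos_of_pos (add_pos_of_pos_of_nonneg (hα.trans hB) hs)).ne'
    field_simp
  have hcont : Continuous fun x : ℝ => x ^ r := Real.continuous_rpow_const hr
  rw [← hbeta hr, ← integral_map hY (f := fun x => x ^ r) hcont.aestronglyMeasurable]
  refine integral_eq_of_moments_eq ((ae_map_iff hY measurableSet_Icc).2 hmem)
    (ae_betaMeasure_mem _ _) (fun m => ?_) hcont
  rw [integral_map hY (by fun_prop), hmom, ← hbeta m.cast_nonneg]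
  simp

/-! ### The explicit generating functions -/

/-- For `b = d / 2`, the coefficients of the generating function of a flight in `ℝ^d` whose
durations have Dirichlet parameter `q` (see `moment_mul_sphereMoment`). The parameter `b` is kept
separate from the dimension because the coefficients of the powers are again of this form, with
another `b`. -/
noncomputable def flightCoeff (q b : ℝ) (k : ℕ) : ℝ :=
  Real.Gamma (q + 2 * k) * Real.Gamma b /
    (Real.Gamma q * (4 ^ k * k.factorial) * Real.Gamma (k + b))

lemma moment_mul_sphereMoment (q : ℝ) (d k : ℕ) :
    Real.Gamma (q + 2 * k) / (Real.Gamma q * (2 * k).factorial) * sphereMoment d k =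
      flightCoeff q ((d : ℝ) / 2) k := by
  have h1 := (Real.Gamma_pos_of_pos (s := (1 : ℝ) / 2) (by positivity)).ne'
  have h2 := (Real.Gamma_pos_of_pos (s := (k : ℝ) + 1 / 2) (by positivity)).ne'
  rw [factorial_two_mul, sphereMoment, flightCoeff]
  field_simp

lemma flightCoeff_half {q : ℝ} (hq : 0 < q) (k : ℕ) :
    flightCoeff q ((q + 1) / 2) k = (negBinomialPoly k).eval (q / 2) := by
  have d1 := Real.Gamma_mul_Gamma_add_half (q / 2)
  have d2 := Real.Gamma_mul_Gamma_add_half (q / 2 + k)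
  have e1 : q / 2 + 1 / 2 = (q + 1) / 2 := by ring
  have e2 : q / 2 + k + 1 / 2 = k + (q + 1) / 2 := by ring
  have e3 : 2 * (q / 2) = q := by ring
  have e4 : 2 * (q / 2 + k) = q + 2 * k := by ring
  have e5 : (2 : ℝ) ^ (1 - (q + 2 * k)) = 2 ^ (1 - q) / 4 ^ k := by
    rw [show (1 : ℝ) - (q + 2 * k) = (1 - q) - ((2 * k : ℕ) : ℝ) by push_cast; ring,
      Real.rpow_sub two_pos, Real.rpow_natCast, pow_mul]
    norm_num
  rw [e1, e3] at d1
  rw [e2, e4, e5] at d2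
  have h1 := (Real.Gamma_pos_of_pos hq).ne'
  have h2 := (Real.Gamma_pos_of_pos (half_pos hq)).ne'
  have h3 := (Real.Gamma_pos_of_pos (s := k + (q + 1) / 2) (by positivity)).ne'
  have h4 : √Real.pi ≠ 0 := (Real.sqrt_pos.2 Real.pi_pos).ne'
  have h5 := (Real.rpow_pos_of_pos two_pos (1 - q)).ne'
  rw [eval_negBinomialPoly (half_pos hq), flightCoeff,
    eq_div_of_mul_eq h3 d2, eq_div_of_mul_eq h2 ((mul_comm _ _).trans d1)]
  field_simp

lemma flightCoeff_add_one {q : ℝ} (hq : 0 < q) (k : ℕ) :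
    flightCoeff q (q + 1) k = (sqrtPowerPoly k).eval q := by
  have h1 := (Real.Gamma_pos_of_pos hq).ne'
  have h2 := (Real.Gamma_pos_of_pos (s := q + k + 1) (by positivity)).ne'
  rw [eval_sqrtPowerPoly hq, flightCoeff, Real.Gamma_add_one hq.ne',
    show (k : ℝ) + (q + 1) = q + k + 1 by ring]
  field_simp

lemma mk_flightCoeff_half_pow {q : ℝ} (hq : 0 < q) (n : ℕ) :
    (PowerSeries.mk (flightCoeff q ((q + 1) / 2))) ^ (n + 1) =
      PowerSeries.mk (flightCoeff ((n + 1) * q) (((n + 1) * q + 1) / 2)) := by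
  rw [funext (flightCoeff_half hq), mk_negBinomialPoly_pow,
    funext (flightCoeff_half (q := (n + 1) * q) (by positivity))]
  push_cast
  simp only [mul_div_assoc]

lemma mk_flightCoeff_add_one_pow {q : ℝ} (hq : 0 < q) (n : ℕ) :
    (PowerSeries.mk (flightCoeff q (q + 1))) ^ (n + 1) =
      PowerSeries.mk (flightCoeff ((n + 1) * q) ((n + 1) * q + 1)) := by
  rw [funext (flightCoeff_add_one hq), mk_sqrtPowerPoly_pow,
    funext (flightCoeff_add_one (q := (n + 1) * q) (by positivity))]
  push_cast
  rfl

/-! ### Moments of the distance -/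

lemma position_eq_smul {d n : ℕ} (c t : ℝ) (s : Fin n → ℝ) (a : Fin (n + 1) → Fin (d - 1) → ℝ) :
    position c t s a = c • unitPosition t s a := rfl

/-- If the `(n + 1)`-st power of the generating function has the coefficients with parameter `B`,
the squared distance at unit speed and unit time has the moments of the beta law with parameters
`d / 2` and `B - d / 2`. -/
theorem IsFlight.integrable_and_integral_norm_rpow {Ω : Type*} [MeasurableSpace Ω] {P : Measure Ω}
    [IsProbabilityMeasure P] {D n : ℕ} {q c t p B : ℝ} (hq : 0 < q) (hc : 0 < c) (ht : 0 < t)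
    (hp : 0 ≤ p) {τ : Ω → Fin n → ℝ} {θ : Fin (n + 1) → Ω → Fin (D + 2 - 1) → ℝ}
    (h : IsFlight P (D + 2) n q t τ θ) (hB : ((D + 2 : ℕ) : ℝ) / 2 < B)
    (hcoeff : (PowerSeries.mk (flightCoeff q (((D + 2 : ℕ) : ℝ) / 2))) ^ (n + 1) =
      PowerSeries.mk (flightCoeff ((n + 1) * q) B)) :
    Integrable (fun ω => ‖position c t (τ ω) (fun j => θ j ω)‖ ^ p) P ∧
      ∫ ω, ‖position c t (τ ω) (fun j => θ j ω)‖ ^ p ∂P =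
        Real.Gamma (((D + 2 : ℕ) : ℝ) / 2 + p / 2) * Real.Gamma B /
          (Real.Gamma (((D + 2 : ℕ) : ℝ) / 2) * Real.Gamma (B + p / 2)) * (c * t) ^ p := by
  set V : Ω → EuclideanSpace ℝ (Fin (D + 2)) := fun ω => unitPosition t (τ ω) fun j => θ j ω with hV
  set α : ℝ := ((D + 2 : ℕ) : ℝ) / 2 with hα
  have hαpos : 0 < α := by rw [hα]; positivity
  have hVm : AEMeasurable V P := h.aemeasurable_unitPosition
  have hle : ∀ᵐ ω ∂P, ‖V ω‖ ≤ t := h.ae_mem.mono fun ω hω => norm_unitPosition_le hω _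
  have hYm : AEMeasurable (fun ω => ‖V ω‖ ^ 2 / t ^ 2) P := (hVm.norm.pow_const 2).div_const _
  have hY : ∀ᵐ ω ∂P, ‖V ω‖ ^ 2 / t ^ 2 ∈ Set.Icc (0 : ℝ) 1 := by
    filter_upwards [hle] with ω hω
    exact ⟨by positivity, (div_le_one (by positivity)).2 (by gcongr)⟩
  have hmom : ∀ m : ℕ, ∫ ω, (‖V ω‖ ^ 2 / t ^ 2) ^ m ∂P =
      Real.Gamma (α + m) * Real.Gamma B / (Real.Gamma α * Real.Gamma (B + m)) := by
    intro m
    have hm := h.integral_norm_pow hq ht m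
    simp only [moment_mul_sphereMoment] at hm
    have hs := sphereMoment_pos (d := D + 2) (by omega) m
    have hQ : 0 < ((n : ℝ) + 1) * q := by positivity
    have g1 := (Real.Gamma_pos_of_pos hQ).ne'
    have g2 := (Real.Gamma_pos_of_pos (s := (n + 1) * q + 2 * m) (by positivity)).ne'
    have g3 := (Real.Gamma_pos_of_pos hαpos).ne'
    have g4 := (Real.Gamma_pos_of_pos (s := B + m)
      (add_pos_of_pos_of_nonneg (hαpos.trans hB) m.cast_nonneg)).ne'
    have g5 := (Real.Gamma_pos_of_pos (s := α + m) (by positivity)).ne'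
    have g6 := (Real.Gamma_pos_of_pos (s := (1 : ℝ) / 2) (by positivity)).ne'
    have g7 := (Real.Gamma_pos_of_pos (s := (m : ℝ) + 1 / 2) (by positivity)).ne'
    simp only [div_pow, ← pow_mul] at hm ⊢
    rw [integral_div]
    refine mul_left_cancel₀ hs.ne' ?_
    rw [mul_div_assoc', hm, hcoeff, PowerSeries.coeff_mk, flightCoeff, factorial_two_mul,
      sphereMoment, ← hα, add_comm (m : ℝ) B, add_comm (m : ℝ) α]
    field_simp
  have heq : ∀ ω, ‖position c t (τ ω) (fun j => θ j ω)‖ ^ p =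
      (c * t) ^ p * (‖V ω‖ ^ 2 / t ^ 2) ^ (p / 2) := by
    intro ω
    rw [position_eq_smul, norm_smul, Real.norm_of_nonneg hc.le, ← div_pow,
      ← Real.rpow_natCast (‖V ω‖ / t) 2, ← Real.rpow_mul (by positivity), Nat.cast_two,
      mul_div_cancel₀ p two_ne_zero, ← Real.mul_rpow (by positivity) (by positivity)]
    congr 1
    field_simp
    rfl
  have hpow := integral_rpow_of_moments hYm hY hαpos hB hmom (by positivity : 0 ≤ p / 2)
  simp only [heq]
  refine ⟨Integrable.const_mul ?_ _, ?_⟩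
  · refine Integrable.of_bound (C := 1) (hYm.pow_const _).aestronglyMeasurable ?_
    filter_upwards [hY] with ω hω
    rw [Real.norm_of_nonneg (Real.rpow_nonneg hω.1 _)]
    exact Real.rpow_le_one hω.1 hω.2 (by positivity)
  · rw [integral_const_mul, hpow, mul_comm]

end RandomFlight

theorem theorem3 {Ω : Type*} [MeasurableSpace Ω] (P : Measure Ω) [IsProbabilityMeasure P]
    (d n : ℕ) (hn : 1 ≤ n) (p : ℝ) (hp : 1 ≤ p) (c t : ℝ) (hc : 0 < c) (ht : 0 < t)
    (τ : Ω → Fin n → ℝ) (θ : Fin (n + 1) → Ω → Fin (d - 1) → ℝ) :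
    (2 ≤ d → RandomFlight.IsFlight P d n ((d : ℝ) - 1) t τ θ →
      Integrable (fun ω => ‖RandomFlight.position c t (τ ω) (fun j => θ j ω)‖ ^ p) P ∧
      ∫ ω, ‖RandomFlight.position c t (τ ω) (fun j => θ j ω)‖ ^ p ∂P =
        Real.Gamma ((p + d) / 2) * Real.Gamma (((n : ℝ) + 1) / 2 * ((d : ℝ) - 1) + 1 / 2) /
          (Real.Gamma ((d : ℝ) / 2) *
            Real.Gamma ((p + d) / 2 + (n : ℝ) / 2 * ((d : ℝ) - 1))) * (c * t) ^ p) ∧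
    (3 ≤ d → RandomFlight.IsFlight P d n ((d : ℝ) / 2 - 1) t τ θ →
      Integrable (fun ω => ‖RandomFlight.position c t (τ ω) (fun j => θ j ω)‖ ^ p) P ∧
      ∫ ω, ‖RandomFlight.position c t (τ ω) (fun j => θ j ω)‖ ^ p ∂P =
        Real.Gamma ((p + d) / 2) * Real.Gamma (((n : ℝ) + 1) * ((d : ℝ) / 2 - 1) + 1) /
          (Real.Gamma ((d : ℝ) / 2) *
            Real.Gamma ((p + d) / 2 + (n : ℝ) * ((d : ℝ) / 2 - 1))) * (c * t) ^ p) := by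
  have hn' : (1 : ℝ) ≤ n := by exact_mod_cast hn
  constructor
  · intro hd h
    obtain ⟨D, rfl⟩ := Nat.exists_eq_add_of_le' hd
    have hd' : (2 : ℝ) ≤ ((D + 2 : ℕ) : ℝ) := by exact_mod_cast hd
    have hq : (0 : ℝ) < ((D + 2 : ℕ) : ℝ) - 1 := by linarith
    have hcoeff := RandomFlight.mk_flightCoeff_half_pow hq n
    rw [sub_add_cancel] at hcoeff
    have key := h.integrable_and_integral_norm_rpow hq hc ht (zero_le_one.trans hp)
      (by nlinarith) hcoeff
    refine ⟨key.1, key.2.trans ?_⟩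
    congr 4 <;> ring
  · intro hd h
    obtain ⟨D, rfl⟩ := Nat.exists_eq_add_of_le' ((by norm_num : 2 ≤ 3).trans hd)
    have hd' : (3 : ℝ) ≤ ((D + 2 : ℕ) : ℝ) := by exact_mod_cast hd
    have hq : (0 : ℝ) < ((D + 2 : ℕ) : ℝ) / 2 - 1 := by linarith
    have hcoeff := RandomFlight.mk_flightCoeff_add_one_pow hq n
    rw [sub_add_cancel] at hcoeff
    have key := h.integrable_and_integral_norm_rpow hq hc ht (zero_le_one.trans hp)
      (by nlinarith) hcoeff
    refine ⟨key.1, key.2.trans ?_⟩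
    congr 4 <;> ring
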